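/- Let $F=\{x_1,x_2,x_3\}=\{0,1,\frac12+i\frac{\sqrt3}{2}\}\subset\mathbb C$ and let $\Psi_i$ be the homothety of ratio $\frac12$ centred at $x_i$. For a blow-up $\omega=(\omega_1,\omega_2,\dots)\in\{1,2,3\}^{\mathbb N}$ set $$F_{<n>}=\Psi_{\omega_1}^{-1}\circ\cdots\circ\Psi_{\omega_n}^{-1}\Big(\bigcup_{j_1,\dots,j_n}\Psi_{j_1}\circ\cdots\circ\Psi_{j_n}(F)\Big),\qquad \partial F_{<n>}=\Psi_{\omega_1}^{-1}\circ\cdots\circ\Psi_{\omega_n}^{-1}(F),$$ $F_{<\infty>}=\bigcup_n F_{<n>}$ and $\partial F_{<\infty>}=\bigcap_n\bigcup_{m\ge n}\partial F_{<m>}$. The cells of $F_{<n>}$ are the $3^n$ unit triangles $\Psi_{\omega_1}^{-1}\circ\cdots\circ\Psi_{\omega_n}^{-1}\circ\Psi_{j_1}\circ\cdots\circ\Psi_{j_n}(F)$, and the cells of $F_{<\infty>}$ are the cells of all the $F_{<n>}$. For $n\le\infty$ let $b_{<n>}(\{x\})$ be the number of cells of $F_{<n>}$ containing $x$, and let $$H^+_{<n>}f(x)=\frac1{b_{<n>}(\{x\})}\sum_{T\ni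 x}\sum_{y\in T}(f(y)-f(x)),$$ where $T$ runs over the cells of $F_{<n>}$ containing $x$ (Neumann condition); for $n=\infty$ this is a bounded operator on $L^2(F_{<\infty>},b_{<\infty>})$. Let $H^-_{<n>}$ be the operator given by the same formula on functions on $F_{<n>}\setminus\partial F_{<n>}$, extended by $0$ to $\partial F_{<n>}$ (Dirichlet condition). Let $\nu^\pm_{<n>}$ ($n<\infty$) be the counting measures, with multiplicity, of the eigenvalues of $H^\pm_{<n>}$, and let $\nu^{ND}_{<n>}=\sum_\lambda d_n(\lambda)\delta_\lambda$, where $d_n(\lambda)$ is the dimension of the space of $f$ on $F_{<n>}$ with $H^+_{<n>}f=\lambda f$ and $f|_{\partial F_{<n>}}=0$. Put $\hat p(v)=v(5+2v)$ and let $\hat p^k$ denote its $k$-th iterate. **Theorem.** (i) For every blow-up $\omega$ the density of states $\mu=\lim_n 3^{-n}\nu^{\pm}_{<n>}$ (weak limit, the same for both boundary conditions) and the density of Neumann–Dirichlet eigenvalues $\mu^{ND}=\lim_n 3^{-n}\nu^{ND}_{<n>}$ (limit on every Borel set) exist, do not depend on $\omega$, and $$\mu=\mu^{ND}=\frac12\,\delta_{-3}+\sum_{k\ge0}\frac{3^{-k-1}}2\Big(\sum_{\lambda\in\mathbb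 R,\ \hat p^k(\lambda)=-3/2}\delta_\lambda+\sum_{\lambda\in\mathbb R,\ \hat p^k(\lambda)=-5/2}\delta_\lambda\Big).$$ (ii) For almost every $\omega$, with respect to the product of the uniform measures on $\{1,2,3\}$, the spectrum of $H^+_{<\infty>}$ and that of $H^-_{<\infty>}$ are pure point with compactly supported eigenfunctions: $L^2(F_{<\infty>},b_{<\infty>})$, respectively its subspace of functions vanishing on $\partial F_{<\infty>}$, has a Hilbert basis of eigenfunctions of $H^+_{<\infty>}$, respectively $H^-_{<\infty>}$, each with finite support. -/

import Mathlib

open MeasureTheory Filter Topology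
open scoped ENNReal BoundedContinuousFunction

namespace SierpinskiLattice

noncomputable section

/-! ### The lattice -/

/-- The three corners of the unit triangle, i.e. the set `F`. -/
def corner : Fin 3 → ℂ := ![0, 1, 1 / 2 + Complex.I * ((Real.sqrt 3 / 2 : ℝ) : ℂ)]

/-- The homothety `Ψ_i` of ratio `1/2` fixing `corner i`. -/
def Psi (i : Fin 3) (z : ℂ) : ℂ := (1 / 2) * (z - corner i) + corner i

/-- The inverse homothety `Ψ_i⁻¹`, of ratio `2`. -/
def PsiInv (i : Fin 3) (z : ℂ) : ℂ := 2 * (z - corner i) + corner i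

theorem PsiInv_Psi (i : Fin 3) (z : ℂ) : PsiInv i (Psi i z) = z := by
  simp [Psi, PsiInv]

theorem Psi_PsiInv (i : Fin 3) (z : ℂ) : Psi i (PsiInv i z) = z := by
  simp [Psi, PsiInv]

/-- `Ψ_{j 0} ∘ ⋯ ∘ Ψ_{j (n-1)}`. -/
def subdivide : (n : ℕ) → (Fin n → Fin 3) → ℂ → ℂ
  | 0, _, z => z
  | n + 1, j, z => Psi (j 0) (subdivide n (Fin.tail j) z)

/-- `Ψ_{ω 0}⁻¹ ∘ ⋯ ∘ Ψ_{ω (n-1)}⁻¹`. -/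
def blowUp (ω : ℕ → Fin 3) : ℕ → ℂ → ℂ
  | 0, z => z
  | n + 1, z => blowUp ω n (PsiInv (ω n) z)

/-- The map sending the basic triangle onto the cell of address `j` of the lattice of level `n`. -/
def cellMap (ω : ℕ → Fin 3) (n : ℕ) (j : Fin n → Fin 3) (z : ℂ) : ℂ :=
  blowUp ω n (subdivide n j z)

theorem subdivide_eq (n : ℕ) (j : Fin n → Fin 3) (z : ℂ) :
    subdivide n j z = subdivide n j 0 + (1 / 2) ^ n * z := by
  induction n with
  | zero => simp [subdivide]
  | succ n ih =>
    simp only [subdivide, Psi]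
    rw [ih (Fin.tail j)]
    ring

theorem blowUp_eq (ω : ℕ → Fin 3) (n : ℕ) (z w : ℂ) :
    blowUp ω n (z + w) = blowUp ω n z + 2 ^ n * w := by
  induction n generalizing z w with
  | zero => simp [blowUp]
  | succ n ih =>
    have h : PsiInv (ω n) (z + w) = PsiInv (ω n) z + 2 * w := by simp only [PsiInv]; ring
    simp only [blowUp]
    rw [h, ih]
    ring

/-- Each cell map is a translation: every cell of the lattice is a translate of the basic
unit triangle. -/
theorem cellMap_eq (ω : ℕ → Fin 3) (n : ℕ) (j : Fin n → Fin 3) (z : ℂ) :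
    cellMap ω n j z = cellMap ω n j 0 + z := by
  simp only [cellMap]
  rw [subdivide_eq, blowUp_eq, ← mul_assoc, ← mul_pow]
  norm_num

/-- The cells of `F_{<n>}`. A cell is encoded by its origin `c`, the image of the corner `0`;
its vertices are then the three points `c + corner a`. -/
def cells (ω : ℕ → Fin 3) (n : ℕ) : Set ℂ := Set.range fun j => cellMap ω n j 0

/-- The cells of the infinite lattice `F_{<∞>}`. -/
def cellsInf (ω : ℕ → Fin 3) : Set ℂ := ⋃ n, cells ω n

/-- The vertices of a family `C` of unit triangles (given by their origins). The lattice
`F_{<n>}` is `verts (cells ω n)`, and `F_{<∞>}` is `verts (cellsInf ω)`. -/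
def verts (C : Set ℂ) : Set ℂ := {z | ∃ c ∈ C, ∃ a, z = c + corner a}

/-- `F_{<n>}` is the set `Ψ_{ω_1}⁻¹ ∘ ⋯ ∘ Ψ_{ω_n}⁻¹ (⋃_j Ψ_{j_1} ∘ ⋯ ∘ Ψ_{j_n} (F))`. -/
theorem verts_cells (ω : ℕ → Fin 3) (n : ℕ) :
    verts (cells ω n) = blowUp ω n '' ⋃ j, subdivide n j '' Set.range corner := by
  ext z
  constructor
  · rintro ⟨_, ⟨j, rfl⟩, a, rfl⟩
    refine ⟨subdivide n j (corner a), Set.mem_iUnion.2 ⟨j, _, ⟨a, rfl⟩, rfl⟩, ?_⟩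
    exact cellMap_eq ω n j (corner a)
  · rintro ⟨_, hw, rfl⟩
    obtain ⟨j, _, ⟨a, rfl⟩, rfl⟩ := Set.mem_iUnion.1 hw
    exact ⟨_, ⟨j, rfl⟩, a, cellMap_eq ω n j (corner a)⟩

/-- The boundary `∂F_{<n>}`: the three corners of the big triangle of level `n`. -/
def boundary (ω : ℕ → Fin 3) (n : ℕ) : Set ℂ := blowUp ω n '' Set.range corner

/-- The boundary `∂F_{<∞>}` of the infinite lattice. -/
def boundaryInf (ω : ℕ → Fin 3) : Set ℂ := ⋂ n, ⋃ m, ⋃ (_ : n ≤ m), boundary ω m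

/-! ### The operators

In this section `C` is a family of unit triangles and `B` is the set of points where the
Dirichlet condition is imposed; `B = ∅` gives Neumann conditions. -/

/-- The vertices of `C` outside `B`, as a discrete space. -/
@[ext]
structure Vertex (C B : Set ℂ) where
  point : ℂ
  mem : point ∈ verts C ∧ point ∉ B

instance (C B : Set ℂ) : MeasurableSpace (Vertex C B) := ⊤

instance (C B : Set ℂ) : DiscreteMeasurableSpace (Vertex C B) := ⟨fun _ => trivial⟩

open Classical in
/-- Extension of a function by `0`, in particular to the points of `B`. -/
def extend {C B : Set ℂ} (f : Vertex C B → ℝ) (z : ℂ) : ℝ :=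
  if h : z ∈ verts C ∧ z ∉ B then f ⟨z, h⟩ else 0

open Classical in
/-- The mass `b({z})`: each cell contributes the counting measure on its three vertices, so
this is the number of cells of `C` containing `z`. -/
def mass (C : Set ℂ) (z : ℂ) : ℕ := ∑ a, if z - corner a ∈ C then 1 else 0

open Classical in
/-- The difference operator: the sum, over the cells of `C` containing `x`, of the copies of
`A f (x) = - ∑_y (f y - f x)`, where `y` runs over the vertices of the cell. -/
def diffOp (C B : Set ℂ) (f : Vertex C B → ℝ) (x : Vertex C B) : ℝ :=
  ∑ a, if x.point - corner a ∈ C then -∑ b, (extend f (x.point - corner a + corner b) - f x) else 0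

theorem extend_add {C B : Set ℂ} (f g : Vertex C B → ℝ) (z : ℂ) :
    extend (f + g) z = extend f z + extend g z := by
  unfold extend; split_ifs <;> simp

theorem extend_smul {C B : Set ℂ} (r : ℝ) (f : Vertex C B → ℝ) (z : ℂ) :
    extend (r • f) z = r * extend f z := by
  unfold extend; split_ifs <;> simp

/-- The operator `H f (x) = - A f (x) / b({x})`, with Dirichlet condition on `B`. -/
def ham (C B : Set ℂ) : (Vertex C B → ℝ) →ₗ[ℝ] (Vertex C B → ℝ) where
  toFun f x := -(1 / (mass C x.point : ℝ)) * diffOp C B f x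
  map_add' f g := by
    funext x
    simp only [Pi.add_apply]
    rw [← mul_add]
    congr 1
    simp only [diffOp, ← Finset.sum_add_distrib]
    refine Finset.sum_congr rfl fun a _ => ?_
    split_ifs
    · rw [← neg_add, ← Finset.sum_add_distrib]
      congr 1
      refine Finset.sum_congr rfl fun b _ => ?_
      rw [extend_add, Pi.add_apply]; ring
    · simp
  map_smul' r f := by
    funext x
    simp only [Pi.smul_apply, smul_eq_mul, RingHom.id_apply]
    rw [mul_left_comm]
    congr 1
    simp only [diffOp, Finset.mul_sum]
    refine Finset.sum_congr rfl fun a _ => ?_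
    split_ifs
    · rw [mul_neg, Finset.mul_sum]
      congr 1
      refine Finset.sum_congr rfl fun b _ => ?_
      rw [extend_smul, Pi.smul_apply, smul_eq_mul]; ring
    · simp

/-- The measure `b` on the vertices outside `B`. -/
def massMeasure (C B : Set ℂ) : Measure (Vertex C B) :=
  Measure.sum fun x => (mass C x.point : ℝ≥0∞) • Measure.dirac x

theorem one_le_mass {C B : Set ℂ} (x : Vertex C B) : 1 ≤ mass C x.point := by
  classical
  obtain ⟨c, hc, a, ha⟩ := x.mem.1
  have h : x.point - corner a ∈ C := by rw [ha]; simpa using hc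
  unfold mass
  calc 1 = (if x.point - corner a ∈ C then 1 else 0) := by rw [if_pos h]
    _ ≤ _ := Finset.single_le_sum (f := fun a => if x.point - corner a ∈ C then 1 else 0)
      (fun _ _ => by positivity) (Finset.mem_univ a)

theorem mass_le_three (C : Set ℂ) (z : ℂ) : mass C z ≤ 3 := by
  classical
  unfold mass
  calc _ ≤ ∑ _a : Fin 3, 1 := Finset.sum_le_sum fun a _ => by split_ifs <;> simp
    _ = 3 := by simp

theorem ham_sq_le {C B : Set ℂ} (f : Vertex C B → ℝ) (x : Vertex C B) :
    (ham C B f x) ^ 2 ≤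
      18 * ∑ a, ∑ b, (extend f (x.point - corner a + corner b) ^ 2 + f x ^ 2) := by
  have hm : (1 : ℝ) ≤ mass C x.point := by exact_mod_cast one_le_mass x
  have h1 : (ham C B f x) ^ 2 ≤ (diffOp C B f x) ^ 2 := by
    change (-(1 / (mass C x.point : ℝ)) * diffOp C B f x) ^ 2 ≤ _
    rw [mul_pow]
    refine mul_le_of_le_one_left (sq_nonneg _) ?_
    rw [neg_sq]
    refine pow_le_one₀ (by positivity) ?_
    rw [div_le_one (by positivity)]
    exact hm
  refine h1.trans ?_
  unfold diffOp
  refine (sq_sum_le_card_mul_sum_sq).trans ?_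
  simp only [Finset.card_univ, Fintype.card_fin]
  rw [Finset.mul_sum, Finset.mul_sum]
  refine Finset.sum_le_sum fun a _ => ?_
  have h2 : (∑ b, (extend f (x.point - corner a + corner b) - f x)) ^ 2 ≤
      3 * ∑ b, 2 * (extend f (x.point - corner a + corner b) ^ 2 + f x ^ 2) := by
    refine (sq_sum_le_card_mul_sum_sq).trans ?_
    simp only [Finset.card_univ, Fintype.card_fin]
    push_cast
    refine mul_le_mul_of_nonneg_left (Finset.sum_le_sum fun b _ => ?_) (by norm_num)
    nlinarith [sq_nonneg (extend f (x.point - corner a + corner b) + f x)]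
  rw [← Finset.mul_sum] at h2
  have h3 : 0 ≤ ∑ b, (extend f (x.point - corner a + corner b) ^ 2 + f x ^ 2) :=
    Finset.sum_nonneg fun b _ => by positivity
  push_cast
  split_ifs
  · rw [neg_sq]; linarith
  · simpa using h3

theorem lintegral_massMeasure {C B : Set ℂ} (g : Vertex C B → ℝ≥0∞) :
    ∫⁻ x, g x ∂massMeasure C B = ∑' x : Vertex C B, (mass C x.point : ℝ≥0∞) * g x := by
  simp [massMeasure, lintegral_sum_measure, lintegral_smul_measure, lintegral_dirac]

theorem tsum_le_lintegral {C B : Set ℂ} (g : Vertex C B → ℝ≥0∞) :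
    ∑' x : Vertex C B, g x ≤ ∫⁻ x, g x ∂massMeasure C B := by
  rw [lintegral_massMeasure]
  refine ENNReal.tsum_le_tsum fun x => ?_
  refine le_mul_of_one_le_left (by simp) ?_
  exact_mod_cast one_le_mass x

theorem tsum_extend_le {C B : Set ℂ} (f : Vertex C B → ℝ) (w : ℂ) :
    ∑' x : Vertex C B, ENNReal.ofReal (extend f (x.point + w) ^ 2) ≤
      ∑' x : Vertex C B, ENNReal.ofReal (f x ^ 2) := by
  have h : Function.Injective fun x : Vertex C B => x.point + w := fun x y hxy =>
    Vertex.ext (add_right_cancel hxy)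
  refine (ENNReal.tsum_comp_le_tsum_of_injective h
    fun z => ENNReal.ofReal (extend f z ^ 2)).trans (le_of_eq ?_)
  have hs : Function.support (fun z => ENNReal.ofReal (extend f z ^ 2)) ⊆
      {z | z ∈ verts C ∧ z ∉ B} := by
    intro z hz
    by_contra hn
    refine hz ?_
    have : extend f z = 0 := dif_neg hn
    simp [this]
  rw [← tsum_subtype_eq_of_support_subset hs]
  let e : Vertex C B ≃ {z | z ∈ verts C ∧ z ∉ B} :=
    ⟨fun x => ⟨x.point, x.mem⟩, fun z => ⟨z.1, z.2⟩, fun _ => rfl, fun _ => rfl⟩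
  rw [← e.tsum_eq]
  refine tsum_congr fun x => ?_
  have : extend f x.point = f x := dif_pos x.mem
  change ENNReal.ofReal (extend f x.point ^ 2) = _
  rw [this]

theorem lintegral_ham_le {C B : Set ℂ} (f : Vertex C B → ℝ) :
    ∫⁻ x, ENNReal.ofReal (ham C B f x ^ 2) ∂massMeasure C B ≤
      1024 * ∫⁻ x, ENNReal.ofReal (f x ^ 2) ∂massMeasure C B := by
  set S := ∑' x : Vertex C B, ENNReal.ofReal (f x ^ 2) with hS
  have hpt : ∀ x : Vertex C B, (mass C x.point : ℝ≥0∞) * ENNReal.ofReal (ham C B f x ^ 2) ≤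
      54 * ∑ a : Fin 3, ∑ b : Fin 3,
        (ENNReal.ofReal (extend f (x.point + (-corner a + corner b)) ^ 2) +
          ENNReal.ofReal (f x ^ 2)) := by
    intro x
    have h1 : (mass C x.point : ℝ≥0∞) ≤ 3 := by exact_mod_cast mass_le_three C x.point
    have h2 := ENNReal.ofReal_le_ofReal (ham_sq_le f x)
    rw [ENNReal.ofReal_mul (by norm_num), ENNReal.ofReal_sum_of_nonneg
      (fun a _ => Finset.sum_nonneg fun b _ => by positivity)] at h2
    refine (mul_le_mul' h1 h2).trans (le_of_eq ?_)
    rw [← mul_assoc]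
    congr 1
    · rw [show (18 : ℝ) = ((18 : ℕ) : ℝ) by norm_num, ENNReal.ofReal_natCast]; norm_num
    · refine Finset.sum_congr rfl fun a _ => ?_
      rw [ENNReal.ofReal_sum_of_nonneg (fun b _ => by positivity)]
      refine Finset.sum_congr rfl fun b _ => ?_
      rw [ENNReal.ofReal_add (by positivity) (by positivity)]
      congr 4
      ring
  have hsum : ∫⁻ x, ENNReal.ofReal (ham C B f x ^ 2) ∂massMeasure C B ≤ 54 * (9 * (S + S)) := by
    rw [lintegral_massMeasure]
    refine (ENNReal.tsum_le_tsum hpt).trans ?_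
    rw [ENNReal.tsum_mul_left]
    refine mul_le_mul' le_rfl ?_
    rw [Summable.tsum_finsetSum fun _ _ => ENNReal.summable]
    have : ∀ a : Fin 3, ∑' x : Vertex C B, ∑ b : Fin 3,
        (ENNReal.ofReal (extend f (x.point + (-corner a + corner b)) ^ 2) +
          ENNReal.ofReal (f x ^ 2)) ≤ 3 * (S + S) := by
      intro a
      rw [Summable.tsum_finsetSum fun _ _ => ENNReal.summable]
      calc _ ≤ ∑ _b : Fin 3, (S + S) := by
            refine Finset.sum_le_sum fun b _ => ?_
            rw [ENNReal.tsum_add]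
            exact add_le_add (tsum_extend_le f _) le_rfl
        _ = 3 * (S + S) := by simp; ring
    calc _ ≤ ∑ _a : Fin 3, 3 * (S + S) := Finset.sum_le_sum fun a _ => this a
      _ = 9 * (S + S) := by
        simp only [Finset.sum_const, Finset.card_univ, Fintype.card_fin, nsmul_eq_mul]
        rw [← mul_assoc]; norm_num
  refine hsum.trans ?_
  have h3 : (54 : ℝ≥0∞) * (9 * (S + S)) = 972 * S := by ring
  rw [h3]
  exact mul_le_mul' (by norm_num) (tsum_le_lintegral _)

theorem eLpNorm_two_eq {C B : Set ℂ} (f : Vertex C B → ℝ) :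
    eLpNorm f 2 (massMeasure C B) =
      (∫⁻ x, ENNReal.ofReal (f x ^ 2) ∂massMeasure C B) ^ (1 / 2 : ℝ) := by
  rw [eLpNorm_eq_lintegral_rpow_enorm_toReal (by norm_num) (by norm_num)]
  simp only [ENNReal.toReal_ofNat]
  congr 2
  funext x
  rw [Real.enorm_eq_ofReal_abs, ← sq_abs (f x), ENNReal.ofReal_pow (abs_nonneg _)]
  norm_cast

theorem eLpNorm_ham_le {C B : Set ℂ} (f : Vertex C B → ℝ) :
    eLpNorm (ham C B f) 2 (massMeasure C B) ≤ 32 * eLpNorm f 2 (massMeasure C B) := by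
  rw [eLpNorm_two_eq, eLpNorm_two_eq]
  refine (ENNReal.rpow_le_rpow (lintegral_ham_le f) (by norm_num)).trans (le_of_eq ?_)
  rw [ENNReal.mul_rpow_of_nonneg _ _ (by norm_num)]
  congr 1
  rw [show (1024 : ℝ≥0∞) = 32 ^ (2 : ℝ) by norm_num, ← ENNReal.rpow_mul]
  norm_num

theorem aestronglyMeasurable_vertex {C B : Set ℂ} (f : Vertex C B → ℝ) :
    AEStronglyMeasurable f (massMeasure C B) :=
  (Measurable.of_discrete (f := f)).aestronglyMeasurable

theorem memLp_ham {C B : Set ℂ} {f : Vertex C B → ℝ} (hf : MemLp f 2 (massMeasure C B)) :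
    MemLp (ham C B f) 2 (massMeasure C B) :=
  ⟨aestronglyMeasurable_vertex _,
    (eLpNorm_ham_le f).trans_lt (ENNReal.mul_lt_top (by norm_num) hf.2)⟩

/-- Every vertex has positive mass, so almost everywhere means everywhere. -/
theorem eq_of_ae_eq {C B : Set ℂ} {f g : Vertex C B → ℝ} (h : f =ᵐ[massMeasure C B] g) :
    f = g := by
  funext x
  by_contra hx
  have h0 : massMeasure C B {y | ¬ f y = g y} = 0 := h
  have h1 : ∑' y : Vertex C B, Set.indicator {y | ¬ f y = g y} (fun _ => (1 : ℝ≥0∞)) y ≤ 0 := by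
    refine (tsum_le_lintegral _).trans (le_of_eq ?_)
    rw [lintegral_indicator (MeasurableSet.of_discrete)]
    simp [h0]
  have h2 := (ENNReal.le_tsum (f := fun y =>
    Set.indicator {y | ¬ f y = g y} (fun _ => (1 : ℝ≥0∞)) y) x).trans h1
  rw [Set.indicator_of_mem (show x ∈ {y | ¬ f y = g y} from hx)] at h2
  simp at h2

/-- The Hilbert space `L²(b)`, of functions vanishing on `B`. -/
abbrev L2 (C B : Set ℂ) : Type := Lp ℝ 2 (massMeasure C B)

/-- The bounded operator on `L²(b)` defined by `ham`. -/
def hamL2 (C B : Set ℂ) : L2 C B →L[ℝ] L2 C B :=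
  LinearMap.mkContinuous
    { toFun := fun f => (memLp_ham (Lp.memLp f)).toLp _
      map_add' := fun f g => by
        rw [← MemLp.toLp_add]
        congr 1
        rw [← map_add]
        congr 1
        exact eq_of_ae_eq (Lp.coeFn_add f g)
      map_smul' := fun r f => by
        rw [RingHom.id_apply, ← MemLp.toLp_const_smul]
        congr 1
        rw [← map_smul]
        congr 1
        exact eq_of_ae_eq (Lp.coeFn_smul r f) }
    32 (fun f => by
      change ‖(memLp_ham (Lp.memLp f)).toLp _‖ ≤ _
      rw [Lp.norm_toLp, Lp.norm_def]
      have h := ENNReal.toReal_mono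
        (ENNReal.mul_ne_top (by norm_num) (Lp.memLp f).2.ne) (eLpNorm_ham_le f)
      rwa [ENNReal.toReal_mul, ENNReal.toReal_ofNat] at h)

/-- The spectrum is pure point with compactly supported eigenfunctions: there is a Hilbert basis
of `L²(b)` made of eigenfunctions of the operator with finite support. -/
def PurePointWithCompactSupport (C B : Set ℂ) : Prop :=
  ∃ (ι : Type) (e : HilbertBasis ι ℝ (L2 C B)), ∀ i,
    (∃ l : ℝ, hamL2 C B (e i) = l • e i) ∧
      {x : Vertex C B | (e i : Vertex C B → ℝ) x ≠ 0}.Finite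

/-! ### The counting measures and their limits -/

/-- The measure `∑_λ d(λ) δ_λ`. -/
def multMeasure (d : ℝ → ℕ) : Measure ℝ :=
  Measure.sum fun l : ℝ => (d l : ℝ≥0∞) • Measure.dirac l

/-- The counting measure of the Neumann eigenvalues at level `n`. -/
def nuPlus (ω : ℕ → Fin 3) (n : ℕ) : Measure ℝ :=
  multMeasure fun l => Module.finrank ℝ (Module.End.eigenspace (ham (cells ω n) ∅) l)

/-- The counting measure of the Dirichlet eigenvalues at level `n`. -/
def nuMinus (ω : ℕ → Fin 3) (n : ℕ) : Measure ℝ :=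
  multMeasure fun l =>
    Module.finrank ℝ (Module.End.eigenspace (ham (cells ω n) (boundary ω n)) l)

/-- The functions on the vertices of `C` vanishing on `D`. -/
def vanishingOn (C D : Set ℂ) : Submodule ℝ (Vertex C ∅ → ℝ) where
  carrier := {f | ∀ x : Vertex C ∅, x.point ∈ D → f x = 0}
  zero_mem' := fun _ _ => rfl
  add_mem' := fun hf hg x hx => by simp [hf x hx, hg x hx]
  smul_mem' := fun r f hf x hx => by simp [hf x hx]

/-- The counting measure of the Neumann-Dirichlet eigenvalues at level `n`: eigenfunctions of
the Neumann operator which vanish on the boundary. -/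
def nuND (ω : ℕ → Fin 3) (n : ℕ) : Measure ℝ :=
  multMeasure fun l => Module.finrank ℝ
    ↥(Module.End.eigenspace (ham (cells ω n) ∅) l ⊓ vanishingOn (cells ω n) (boundary ω n))

/-- `μ` is the density of states: it is the weak limit of `3⁻ⁿ ν_{<n>}^±`, for both boundary
conditions. -/
def IsDensityOfStates (ω : ℕ → Fin 3) (μ : Measure ℝ) : Prop :=
  IsFiniteMeasure μ ∧ ∀ f : ℝ →ᵇ ℝ,
    Tendsto (fun n : ℕ => (1 / 3 ^ n : ℝ) * ∫ l, f l ∂nuPlus ω n) atTop (𝓝 (∫ l, f l ∂μ)) ∧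
    Tendsto (fun n : ℕ => (1 / 3 ^ n : ℝ) * ∫ l, f l ∂nuMinus ω n) atTop (𝓝 (∫ l, f l ∂μ))

/-- `μ` is the density of Neumann-Dirichlet eigenvalues: it is the limit, on every Borel set,
of the (nondecreasing) sequence of measures `3⁻ⁿ ν_{<n>}^{ND}`. -/
def IsNDDensity (ω : ℕ → Fin 3) (μ : Measure ℝ) : Prop :=
  ∀ s : Set ℝ, MeasurableSet s →
    Tendsto (fun n : ℕ => ((3 : ℝ≥0∞) ^ n)⁻¹ * nuND ω n s) atTop (𝓝 (μ s))

/-- The polynomial `p̂(v) = v (5 + 2 v)`. -/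
def pHat (v : ℝ) : ℝ := v * (5 + 2 * v)

/-- `∑_{λ : p̂^k(λ) = t} δ_λ`. -/
def preimageMeasure (k : ℕ) (t : ℝ) : Measure ℝ :=
  Measure.sum fun l : {l : ℝ // pHat^[k] l = t} => Measure.dirac l.1

/-- `½ δ_{-3} + ∑_{k ≥ 0} (3^{-k-1} / 2) (∑_{p̂^k(λ) = -3/2} δ_λ + ∑_{p̂^k(λ) = -5/2} δ_λ)`. -/
def gasketDensity : Measure ℝ :=
  (1 / 2 : ℝ≥0∞) • Measure.dirac (-3) +
    Measure.sum fun k : ℕ =>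
      (((3 : ℝ≥0∞) ^ (k + 1))⁻¹ / 2) • (preimageMeasure k (-3 / 2) + preimageMeasure k (-5 / 2))

/-- The law of the blow-up: the product of the uniform measures on the three symbols. -/
def blowUpLaw : Measure (ℕ → Fin 3) :=
  Measure.infinitePi fun _ => (PMF.uniformOfFintype (Fin 3)).toMeasure

end

end SierpinskiLattice

/-!
# The spectrum of the Sierpinski lattices

All cells of a lattice are translates of the unit triangle, so the lattice of level `n` is a
translate of a fixed set of cells, `gasket n`, whatever the blow-up is; only the translation
depends on the blow-up. Write `d_n(l)` for the dimension of the space of Neumann-Dirichlet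
eigenfunctions of `gasket n` for the eigenvalue `l`. Extended by `0`, such an eigenfunction is an
eigenfunction for the Neumann condition, for the Dirichlet condition, and on the infinite lattice,
because two triangles of the same level meet only at their corners
(`translate_mem_eigenspace`, `mem_boundary_of_not_mem_cells`).

*Lower bounds for the multiplicities.* For the eigenvalue `-3` the eigenvalue equation at a vertex
says that the sums over the cells containing it cancel, so every function with sum `0` over each
cell is an eigenfunction. There are `3 ^ n` cells and `(3 ^ (n + 1) + 3) / 2` vertices, and a
dimension count gives `d_n(-3) ≥ (3 ^ n - 3) / 2`. A similar count gives
`d_(n+1)(-5/2) ≥ (3 ^ n - 3) / 2`. Spectral decimation (`eigenSum_decimationExtension`) extends an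
eigenfunction for `pHat l` to an eigenfunction for `l` on the subdivided lattice, hence
`d_(n+1)(l) ≥ d_n(pHat l)` for `l ≠ -1, -5/2`. As `pHat (-3/2) = -3`, this bounds from below the
multiplicity of every atom of `gasketDensity`.

*Upper bounds come for free.* Each point of `[-5/2, 0]` has two preimages in `[-5/2, 0]` under
`pHat`, so `gasketDensity` has total mass `3 / 2`, which is also the limit of `3⁻ⁿ` times the
number of vertices. No counting measure can have more mass than there are vertices, so the lower
bounds are sharp in the limit, for the three counting measures at once (`tendsto_tsum_mul`).

*Pure point spectrum.* It follows that the codimension of the span of the Neumann-Dirichlet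
eigenfunctions of level `n` is `o(3 ^ n)`. This codimension is the sum over the vertices `x` of
`gasket n` of the squared distance from the indicator function of `x` to that span. A given point
of the infinite lattice is a random vertex of `gasket n`, each vertex having probability at most
`3⁻ⁿ`, so that its expected squared distance tends to `0`. Hence almost surely all indicator
functions are limits of combinations of eigenfunctions with finite support, and the Gram-Schmidt
process, which preserves eigenfunctions as eigenspaces are orthogonal, produces the Hilbert basis.
Almost surely the blow-up is not eventually constant; then the infinite lattice has no boundary
and the Dirichlet operator is the Neumann operator.
-/

namespace SierpinskiLattice

/-! ### The triangular lattice -/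

/-- The point of the triangular lattice with coordinates `(p, q)` in the basis of the two sides of
the unit triangle issued from `0`. -/
noncomputable def latticePoint (p q : ℤ) : ℂ := p + q * corner 2

/-- The first coordinate of a corner of the unit triangle. -/
def cornerFst : Fin 3 → ℤ := ![0, 1, 0]

/-- The second coordinate of a corner of the unit triangle. -/
def cornerSnd : Fin 3 → ℤ := ![0, 0, 1]

theorem corner_eq (a : Fin 3) : corner a = latticePoint (cornerFst a) (cornerSnd a) := by
  fin_cases a <;> simp [corner, latticePoint, cornerFst, cornerSnd]

theorem latticePoint_add (p q p' q' : ℤ) :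
    latticePoint p q + latticePoint p' q' = latticePoint (p + p') (q + q') := by
  simp only [latticePoint]; push_cast; ring

theorem two_mul_latticePoint (p q : ℤ) :
    2 * latticePoint p q = latticePoint (2 * p) (2 * q) := by
  simp only [latticePoint]; push_cast; ring

theorem two_pow_mul_corner (n : ℕ) (a : Fin 3) :
    2 ^ n * corner a = latticePoint (2 ^ n * cornerFst a) (2 ^ n * cornerSnd a) := by
  rw [corner_eq]; simp only [latticePoint]; push_cast; ring

theorem latticePoint_inj {p q p' q' : ℤ} (h : latticePoint p q = latticePoint p' q') :
    p = p' ∧ q = q' := by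
  have hs : (0 : ℝ) < Real.sqrt 3 := Real.sqrt_pos.2 (by norm_num)
  have him := congrArg Complex.im h
  have hre := congrArg Complex.re h
  simp [latticePoint, corner, hs.ne'] at him hre
  subst him
  exact ⟨by simpa using hre, rfl⟩

/-- The triangular lattice. -/
def triLattice : Set ℂ := {z | ∃ p q : ℤ, z = latticePoint p q}

theorem corner_mem_triLattice (a : Fin 3) : corner a ∈ triLattice := ⟨_, _, corner_eq a⟩

theorem add_mem_triLattice {z w : ℂ} (hz : z ∈ triLattice) (hw : w ∈ triLattice) :
    z + w ∈ triLattice := by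
  obtain ⟨p, q, rfl⟩ := hz
  obtain ⟨p', q', rfl⟩ := hw
  exact ⟨_, _, latticePoint_add _ _ _ _⟩

theorem two_mul_mem_triLattice {z : ℂ} (hz : z ∈ triLattice) : 2 * z ∈ triLattice := by
  obtain ⟨p, q, rfl⟩ := hz
  exact ⟨_, _, two_mul_latticePoint _ _⟩

theorem countable_triLattice : triLattice.Countable := by
  have : triLattice = Set.range fun r : ℤ × ℤ => latticePoint r.1 r.2 := by
    ext z
    constructor
    · rintro ⟨p, q, rfl⟩; exact ⟨(p, q), rfl⟩
    · rintro ⟨r, rfl⟩; exact ⟨_, _, rfl⟩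
  rw [this]
  exact Set.countable_range _

theorem corner_injective : Function.Injective corner := by
  intro a b h
  rw [corner_eq, corner_eq] at h
  have := latticePoint_inj h
  revert this
  fin_cases a <;> fin_cases b <;> simp [cornerFst, cornerSnd]

/-- The vertices of the subdivision of a family of unit triangles, enlarged by the factor `2`, are
the points `2 * u + corner a + corner b`. Reducing the coordinates modulo `2` recovers the type of
such a vertex: it is either an old vertex (`a = b`), or the midpoint of a side of a unique
triangle. -/
theorem two_mul_add_corner_add_corner {u u' : ℂ} (hu : u ∈ triLattice) (hu' : u' ∈ triLattice)
    {a b a' b' : Fin 3}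
    (h : 2 * u + corner a + corner b = 2 * u' + corner a' + corner b') :
    (a = b ∧ a' = b' ∧ u + corner a = u' + corner a') ∨
      (a ≠ b ∧ u = u' ∧ (a = a' ∧ b = b' ∨ a = b' ∧ b = a')) := by
  obtain ⟨p, q, rfl⟩ := hu
  obtain ⟨p', q', rfl⟩ := hu'
  simp only [corner_eq, two_mul_latticePoint, latticePoint_add] at h
  obtain ⟨h1, h2⟩ := latticePoint_inj h
  have key : (a = b ∧ a' = b' ∧ p + cornerFst a = p' + cornerFst a' ∧
      q + cornerSnd a = q' + cornerSnd a') ∨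
      (a ≠ b ∧ (p = p' ∧ q = q') ∧ (a = a' ∧ b = b' ∨ a = b' ∧ b = a')) := by
    clear h
    revert h1 h2
    fin_cases a <;> fin_cases b <;> fin_cases a' <;> fin_cases b' <;>
      simp [cornerFst, cornerSnd] <;> omega
  rcases key with ⟨h3, h4, h5, h6⟩ | ⟨h3, ⟨rfl, rfl⟩, h5⟩
  · refine Or.inl ⟨h3, h4, ?_⟩
    rw [corner_eq, corner_eq, latticePoint_add, latticePoint_add, h5, h6]
  · exact Or.inr ⟨h3, rfl, h5⟩

/-- A vertex of the subdivision which is an old vertex. -/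
theorem two_mul_eq {u c : ℂ} (hu : u ∈ triLattice) (hc : c ∈ triLattice) {a b : Fin 3}
    (h : 2 * u = 2 * c + corner a + corner b) : a = b ∧ u = c + corner a := by
  have h' : 2 * u + corner 0 + corner 0 = 2 * c + corner a + corner b := by
    rw [← h]; simp [corner]
  rcases two_mul_add_corner_add_corner hu hc h' with ⟨_, h2, h3⟩ | ⟨h1, _⟩
  · exact ⟨h2, by rw [← h3]; simp [corner]⟩
  · exact absurd rfl h1

/-! ### Subdividing a family of triangles -/

/-- The family obtained from `C` by subdividing each triangle into three triangles of half the
size, and rescaling by the factor `2` so that these are unit triangles again. -/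
def refined (C : Set ℂ) : Set ℂ := {z | ∃ c ∈ C, ∃ a, z = 2 * c + corner a}

theorem refined_subset {C : Set ℂ} (hC : C ⊆ triLattice) : refined C ⊆ triLattice := by
  rintro _ ⟨c, hc, a, rfl⟩
  exact add_mem_triLattice (two_mul_mem_triLattice (hC hc)) (corner_mem_triLattice a)

theorem verts_subset {C : Set ℂ} (hC : C ⊆ triLattice) : verts C ⊆ triLattice := by
  rintro _ ⟨c, hc, a, rfl⟩
  exact add_mem_triLattice (hC hc) (corner_mem_triLattice a)

theorem mem_verts_refined {C : Set ℂ} {z : ℂ} :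
    z ∈ verts (refined C) ↔ ∃ c ∈ C, ∃ a b, z = 2 * c + corner a + corner b := by
  constructor
  · rintro ⟨_, ⟨c, hc, a, rfl⟩, b, rfl⟩
    exact ⟨c, hc, a, b, rfl⟩
  · rintro ⟨c, hc, a, b, rfl⟩
    exact ⟨_, ⟨c, hc, a, rfl⟩, b, rfl⟩

theorem refined_eq_image (C : Set ℂ) :
    refined C = (fun r : ℂ × Fin 3 => 2 * r.1 + corner r.2) '' (C ×ˢ Set.univ) := by
  ext z
  constructor
  · rintro ⟨c, hc, a, rfl⟩; exact ⟨(c, a), ⟨hc, trivial⟩, rfl⟩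
  · rintro ⟨⟨c, a⟩, ⟨hc, -⟩, rfl⟩; exact ⟨c, hc, a, rfl⟩

theorem verts_eq_image (C : Set ℂ) :
    verts C = (fun r : ℂ × Fin 3 => r.1 + corner r.2) '' (C ×ˢ Set.univ) := by
  ext z
  constructor
  · rintro ⟨c, hc, a, rfl⟩; exact ⟨(c, a), ⟨hc, trivial⟩, rfl⟩
  · rintro ⟨⟨c, a⟩, ⟨hc, -⟩, rfl⟩; exact ⟨c, hc, a, rfl⟩

theorem finite_refined {C : Set ℂ} (hC : C.Finite) : (refined C).Finite := by
  rw [refined_eq_image]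
  exact (hC.prod Set.finite_univ).image _

theorem finite_verts {C : Set ℂ} (hC : C.Finite) : (verts C).Finite := by
  rw [verts_eq_image]
  exact (hC.prod Set.finite_univ).image _

theorem ncard_refined {C : Set ℂ} (hC : C ⊆ triLattice) : (refined C).ncard = 3 * C.ncard := by
  rw [refined_eq_image, Set.InjOn.ncard_image, Set.ncard_prod]
  · simp [Set.ncard_univ, mul_comm]
  · rintro ⟨c, a⟩ ⟨hc, -⟩ ⟨c', a'⟩ ⟨hc', -⟩ h
    have h' : 2 * c + corner a + corner 0 = 2 * c' + corner a' + corner 0 := by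
      simpa [corner] using h
    rcases two_mul_add_corner_add_corner (hC hc) (hC hc') h' with
      ⟨rfl, rfl, h3⟩ | ⟨h1, rfl, ⟨rfl, -⟩ | ⟨h4, -⟩⟩
    · simpa using h3
    · rfl
    · exact absurd h4 h1

/-- The midpoint of the side opposite to the corner `a`, in the enlarged triangle `c`. -/
noncomputable def midpointOpp (c : ℂ) (a : Fin 3) : ℂ := 2 * c + corner (a + 1) + corner (a + 2)

theorem ncard_verts_refined {C : Set ℂ} (hC : C ⊆ triLattice) (hfin : C.Finite) :
    (verts (refined C)).ncard = (verts C).ncard + 3 * C.ncard := by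
  have hsplit : verts (refined C) =
      (fun z => 2 * z) '' verts C ∪
        (fun r : ℂ × Fin 3 => midpointOpp r.1 r.2) '' (C ×ˢ Set.univ) := by
    ext z
    rw [mem_verts_refined]
    constructor
    · rintro ⟨c, hc, a, b, rfl⟩
      by_cases hab : a = b
      · subst hab
        exact Or.inl ⟨c + corner a, ⟨c, hc, a, rfl⟩, by ring⟩
      · refine Or.inr ⟨(c, -(a + b)), ⟨hc, trivial⟩, ?_⟩
        simp only [midpointOpp]
        fin_cases a <;> fin_cases b <;> first | exact absurd rfl hab | skip
        all_goals simp [show (-1 : Fin 3) = 2 by decide, show (-2 : Fin 3) = 1 by decide,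
          show (2 + 1 : Fin 3) = 0 by decide, show (2 + 2 : Fin 3) = 1 by decide,
          show (1 + 1 : Fin 3) = 2 by decide, show (1 + 2 : Fin 3) = 0 by decide]
        all_goals ring
    · rintro (⟨_, ⟨c, hc, a, rfl⟩, rfl⟩ | ⟨⟨c, a⟩, ⟨hc, -⟩, rfl⟩)
      · exact ⟨c, hc, a, a, by ring⟩
      · exact ⟨c, hc, _, _, rfl⟩
  have hne : ∀ a : Fin 3, a + 1 ≠ a + 2 := by decide
  have hmid : ∀ a a' : Fin 3, a + 1 = a' + 2 → a + 2 ≠ a' + 1 := by decide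
  rw [hsplit, Set.ncard_union_eq ?_ ((finite_verts hfin).image _)
    ((hfin.prod Set.finite_univ).image _), Set.ncard_image_of_injective, Set.InjOn.ncard_image,
    Set.ncard_prod]
  · simp [Set.ncard_univ, mul_comm]
  · rintro ⟨c, a⟩ ⟨hc, -⟩ ⟨c', a'⟩ ⟨hc', -⟩ h
    rcases two_mul_add_corner_add_corner (hC hc) (hC hc') h with
      ⟨h1, -⟩ | ⟨-, rfl, ⟨h1, -⟩ | ⟨h1, h2⟩⟩
    · exact absurd h1 (hne a)
    · exact Prod.ext rfl (add_right_cancel h1)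
    · exact absurd h2 (hmid a a' h1)
  · exact fun z w h => mul_left_cancel₀ two_ne_zero h
  · rw [Set.disjoint_left]
    rintro _ ⟨u, hu, rfl⟩ ⟨⟨c, a⟩, ⟨hc, -⟩, h⟩
    exact hne a (two_mul_eq (verts_subset hC hu) (hC hc) h.symm).1

/-! ### The lattice of level `n` up to translation -/

/-- The cells of the big triangle of level `n` with corners `2 ^ n * corner a`. -/
def gasket : ℕ → Set ℂ
  | 0 => {0}
  | n + 1 => refined (gasket n)

/-- The three corners of the big triangle of level `n`. -/
def gasketBoundary (n : ℕ) : Set ℂ := Set.range fun a => 2 ^ n * corner a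

/-- The translation that takes the lattice of level `n` with blow-up `ω` to `gasket n`. -/
noncomputable def shift (ω : ℕ → Fin 3) (n : ℕ) : ℂ := ∑ k ∈ Finset.range n, 2 ^ k * corner (ω k)

theorem shift_succ (ω : ℕ → Fin 3) (n : ℕ) : shift ω (n + 1) = shift ω n + 2 ^ n * corner (ω n) :=
  Finset.sum_range_succ _ _

theorem gasket_subset (n : ℕ) : gasket n ⊆ triLattice := by
  induction n with
  | zero =>
    rintro _ rfl
    exact ⟨0, 0, by simp [latticePoint]⟩
  | succ n ih => exact refined_subset ih

theorem finite_gasket (n : ℕ) : (gasket n).Finite := by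
  induction n with
  | zero => exact Set.finite_singleton _
  | succ n ih => exact finite_refined ih

theorem ncard_gasket (n : ℕ) : (gasket n).ncard = 3 ^ n := by
  induction n with
  | zero => simp [gasket]
  | succ n ih => rw [gasket, ncard_refined (gasket_subset n), ih, pow_succ']

theorem two_mul_ncard_verts_gasket (n : ℕ) : 2 * (verts (gasket n)).ncard = 3 ^ (n + 1) + 3 := by
  induction n with
  | zero =>
    have : verts (gasket 0) = Set.range corner := by
      ext z; simp [verts, gasket, eq_comm]
    rw [this, ← Set.image_univ, Set.ncard_image_of_injective _ corner_injective]
    simp [Set.ncard_univ]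
  | succ n ih =>
    rw [gasket, ncard_verts_refined (gasket_subset n) (finite_gasket n), ncard_gasket, mul_add, ih]
    ring

/-- `gasket (n + 1)` consists of three copies of `gasket n`. -/
theorem mem_gasket_succ {n : ℕ} {z : ℂ} :
    z ∈ gasket (n + 1) ↔ ∃ c ∈ gasket n, ∃ a, z = c + 2 ^ n * corner a := by
  induction n generalizing z with
  | zero => simp [gasket, refined]
  | succ n ih =>
    constructor
    · rintro ⟨c, hc, a, rfl⟩
      obtain ⟨c', hc', b, rfl⟩ := ih.1 hc
      exact ⟨2 * c' + corner a, ⟨c', hc', a, rfl⟩, b, by ring⟩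
    · rintro ⟨_, ⟨c, hc, a, rfl⟩, b, rfl⟩
      exact ⟨c + 2 ^ n * corner b, ih.2 ⟨c, hc, b, rfl⟩, a, by ring⟩

theorem mem_gasket_iff_subdivide {n : ℕ} {z : ℂ} :
    z ∈ gasket n ↔ ∃ j, z = 2 ^ n * subdivide n j 0 := by
  induction n generalizing z with
  | zero => simp [gasket, subdivide]
  | succ n ih =>
    rw [mem_gasket_succ]
    constructor
    · rintro ⟨c, hc, a, rfl⟩
      obtain ⟨j, rfl⟩ := ih.1 hc
      refine ⟨Fin.cons a j, ?_⟩
      simp only [subdivide, Fin.cons_zero, Fin.tail_cons, Psi]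
      ring
    · rintro ⟨j, rfl⟩
      refine ⟨_, ih.2 ⟨Fin.tail j, rfl⟩, j 0, ?_⟩
      simp only [subdivide, Psi]
      ring

theorem blowUp_eq_shift (ω : ℕ → Fin 3) (n : ℕ) (z : ℂ) :
    blowUp ω n z = 2 ^ n * z - shift ω n := by
  induction n generalizing z with
  | zero => simp [blowUp, shift]
  | succ n ih =>
    simp only [blowUp]
    rw [ih, shift_succ, PsiInv]
    ring

theorem mem_cells_iff {ω : ℕ → Fin 3} {n : ℕ} {z : ℂ} :
    z ∈ cells ω n ↔ z + shift ω n ∈ gasket n := by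
  rw [mem_gasket_iff_subdivide]
  simp only [cells, Set.mem_range, cellMap, blowUp_eq_shift]
  exact exists_congr fun j => ⟨fun h => by rw [← h]; ring, fun h => by rw [← h]; ring⟩

theorem mem_boundary_iff {ω : ℕ → Fin 3} {n : ℕ} {z : ℂ} :
    z ∈ boundary ω n ↔ z + shift ω n ∈ gasketBoundary n := by
  simp only [boundary, gasketBoundary, Set.mem_image, Set.mem_range, exists_exists_eq_and,
    blowUp_eq_shift]
  exact exists_congr fun j => ⟨fun h => by rw [← h]; ring, fun h => by rw [h]; ring⟩

theorem mem_verts_cells_iff {ω : ℕ → Fin 3} {n : ℕ} {z : ℂ} :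
    z ∈ verts (cells ω n) ↔ z + shift ω n ∈ verts (gasket n) := by
  constructor
  · rintro ⟨c, hc, a, rfl⟩
    exact ⟨_, mem_cells_iff.1 hc, a, by ring⟩
  · rintro ⟨c, hc, a, h⟩
    refine ⟨c - shift ω n, mem_cells_iff.2 (by simpa using hc), a, ?_⟩
    linear_combination h

theorem cells_subset_succ (ω : ℕ → Fin 3) (n : ℕ) : cells ω n ⊆ cells ω (n + 1) := by
  intro z hz
  rw [mem_cells_iff] at hz ⊢
  rw [mem_gasket_succ, shift_succ]
  exact ⟨_, hz, ω n, by ring⟩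

theorem cells_mono (ω : ℕ → Fin 3) : Monotone (cells ω) :=
  monotone_nat_of_le_succ (cells_subset_succ ω)

theorem verts_mono {C C' : Set ℂ} (h : C ⊆ C') : verts C ⊆ verts C' := by
  rintro _ ⟨c, hc, a, rfl⟩
  exact ⟨c, h hc, a, rfl⟩

theorem gasketBoundary_subset (n : ℕ) : gasketBoundary n ⊆ verts (gasket n) := by
  induction n with
  | zero =>
    rintro _ ⟨a, rfl⟩
    exact ⟨0, rfl, a, by simp⟩
  | succ n ih =>
    rintro _ ⟨a, rfl⟩
    obtain ⟨c, hc, b, h⟩ := ih ⟨a, rfl⟩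
    refine ⟨c + 2 ^ n * corner a, mem_gasket_succ.2 ⟨c, hc, a, rfl⟩, b, ?_⟩
    simp only at h ⊢
    linear_combination 2 * h - h

/-- The lattice of level `n` is contained in the triangle spanned by its corners. -/
theorem exists_coords_of_mem_verts_gasket {n : ℕ} {z : ℂ} (hz : z ∈ verts (gasket n)) :
    ∃ p q : ℤ, z = latticePoint p q ∧ 0 ≤ p ∧ 0 ≤ q ∧ p + q ≤ 2 ^ n := by
  induction n generalizing z with
  | zero =>
    obtain ⟨_, rfl, a, rfl⟩ := hz
    refine ⟨cornerFst a, cornerSnd a, by rw [zero_add, corner_eq], ?_⟩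
    fin_cases a <;> simp [cornerFst, cornerSnd]
  | succ n ih =>
    obtain ⟨_, hc', b, rfl⟩ := hz
    obtain ⟨c, hc, a, rfl⟩ := mem_gasket_succ.1 hc'
    obtain ⟨p, q, h, hp, hq, hpq⟩ := ih ⟨c, hc, b, rfl⟩
    refine ⟨p + 2 ^ n * cornerFst a, q + 2 ^ n * cornerSnd a, ?_, ?_⟩
    · rw [← latticePoint_add, ← h, ← two_pow_mul_corner]; ring
    · have h2 : (0 : ℤ) < 2 ^ n := by positivity
      rw [pow_succ]
      fin_cases a <;> simp [cornerFst, cornerSnd] <;> omega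

/-- Two of the three copies of `gasket n` meet only at a corner of each of them. -/
theorem mem_gasketBoundary_of_copies {n : ℕ} {z : ℂ} {a b : Fin 3} (hab : a ≠ b)
    (hz : z ∈ verts (gasket n)) (hz' : z + 2 ^ n * corner a - 2 ^ n * corner b ∈ verts (gasket n)) :
    z ∈ gasketBoundary n := by
  obtain ⟨p, q, rfl, hp, hq, hpq⟩ := exists_coords_of_mem_verts_gasket hz
  obtain ⟨p', q', h, hp', hq', hpq'⟩ := exists_coords_of_mem_verts_gasket hz'
  rw [sub_eq_iff_eq_add, two_pow_mul_corner, two_pow_mul_corner, latticePoint_add,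
    latticePoint_add] at h
  obtain ⟨h1, h2⟩ := latticePoint_inj h
  refine ⟨b, ?_⟩
  simp only
  rw [two_pow_mul_corner]
  have h3 : 2 ^ n * cornerFst b = p ∧ 2 ^ n * cornerSnd b = q := by
    clear h hz hz'
    revert h1 h2 hab
    fin_cases a <;> fin_cases b <;> simp [cornerFst, cornerSnd] <;> omega
  rw [h3.1, h3.2]

/-- A corner of the lattice of level `n + 1` which lies in the copy `a` of the lattice of level `n`
is a corner of that copy, namely its corner `a`. -/
theorem eq_corner_of_mem_gasketBoundary_succ {n : ℕ} {z : ℂ} {a b : Fin 3}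
    (hz : z ∈ verts (gasket n)) (h : z + 2 ^ n * corner a = 2 ^ (n + 1) * corner b) :
    a = b ∧ z = 2 ^ n * corner a := by
  obtain ⟨p, q, rfl, hp, hq, hpq⟩ := exists_coords_of_mem_verts_gasket hz
  rw [two_pow_mul_corner, two_pow_mul_corner, latticePoint_add, pow_succ] at h
  obtain ⟨h1, h2⟩ := latticePoint_inj h
  have h4 : (0 : ℤ) < 2 ^ n := by positivity
  have h3 : a = b ∧ p = 2 ^ n * cornerFst a ∧ q = 2 ^ n * cornerSnd a := by
    clear h hz
    revert h1 h2
    fin_cases a <;> fin_cases b <;> simp [cornerFst, cornerSnd] <;> omega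
  refine ⟨h3.1, ?_⟩
  rw [two_pow_mul_corner, h3.2.1, h3.2.2]

theorem mem_boundary_of_mem_boundary_succ {ω : ℕ → Fin 3} {n : ℕ} {z : ℂ}
    (hz : z ∈ verts (cells ω n)) (h : z ∈ boundary ω (n + 1)) : z ∈ boundary ω n := by
  rw [mem_boundary_iff] at h ⊢
  obtain ⟨b, hb⟩ := h
  rw [shift_succ, ← add_assoc] at hb
  exact ⟨_, (eq_corner_of_mem_gasketBoundary_succ (mem_verts_cells_iff.1 hz) hb.symm).2.symm⟩

theorem mem_boundary_of_le {ω : ℕ → Fin 3} {m n : ℕ} (hmn : m ≤ n) {z : ℂ}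
    (hz : z ∈ verts (cells ω m)) (h : z ∈ boundary ω n) : z ∈ boundary ω m := by
  induction n, hmn using Nat.le_induction with
  | base => exact h
  | succ n hmn ih =>
    exact ih (mem_boundary_of_mem_boundary_succ (verts_mono (cells_mono ω hmn) hz) h)

/-- A cell of the infinite lattice outside the lattice of level `n` meets the latter only along its
boundary. -/
theorem mem_boundary_of_not_mem_cells {ω : ℕ → Fin 3} {n : ℕ} {c : ℂ} (hc : c ∈ cellsInf ω)
    (hcn : c ∉ cells ω n) {a : Fin 3} (hv : c + corner a ∈ verts (cells ω n)) :
    c + corner a ∈ boundary ω n := by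
  obtain ⟨m, hm⟩ := Set.mem_iUnion.1 hc
  have hnm : n ≤ m := by
    by_contra hlt
    exact hcn (cells_mono ω (not_le.1 hlt).le hm)
  induction m, hnm using Nat.le_induction with
  | base => exact absurd hm hcn
  | succ m hnm ih =>
    by_cases h : c ∈ cells ω m
    · exact ih h
    refine mem_boundary_of_le hnm hv ?_
    rw [mem_cells_iff, mem_gasket_succ] at hm
    obtain ⟨d, hd, b, hdb⟩ := hm
    rw [shift_succ] at hdb
    rw [mem_boundary_iff]
    refine mem_gasketBoundary_of_copies (a := ω m) (b := b) ?_
      (mem_verts_cells_iff.1 (verts_mono (cells_mono ω hnm) hv)) ⟨d, hd, a, ?_⟩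
    · rintro rfl
      refine h (mem_cells_iff.2 ?_)
      rwa [show c + shift ω m = d by linear_combination hdb]
    · linear_combination hdb

/-- The infinite lattice has a boundary point only if the blow-up is eventually constant. -/
theorem eventually_const_of_mem_boundaryInf {ω : ℕ → Fin 3} {z : ℂ} (hz : z ∈ boundaryInf ω) :
    ∃ m a, ∀ n ≥ m, ω n = a := by
  simp only [boundaryInf, Set.mem_iInter, Set.mem_iUnion, exists_prop] at hz
  obtain ⟨m, -, hm⟩ := hz 0
  have hv : z ∈ verts (cells ω m) :=
    mem_verts_cells_iff.2 (gasketBoundary_subset m (mem_boundary_iff.1 hm))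
  have hall : ∀ n ≥ m, z ∈ boundary ω n := fun n hn => by
    obtain ⟨k, hk, hzk⟩ := hz n
    exact mem_boundary_of_le hk (verts_mono (cells_mono ω hn) hv) hzk
  obtain ⟨a, ha⟩ := mem_boundary_iff.1 hm
  have step : ∀ n ≥ m, z + shift ω n = 2 ^ n * corner a →
      ω n = a ∧ z + shift ω (n + 1) = 2 ^ (n + 1) * corner a := by
    intro n hn h
    obtain ⟨b, hb⟩ := mem_boundary_iff.1 (hall (n + 1) (by omega))
    have hb' := hb
    simp only at hb
    rw [shift_succ, ← add_assoc] at hb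
    obtain ⟨h1, h2⟩ := eq_corner_of_mem_gasketBoundary_succ
      (mem_verts_cells_iff.1 (verts_mono (cells_mono ω hn) hv)) hb.symm
    have h3 : ω n = a := by
      rw [h] at h2
      exact (corner_injective (mul_left_cancel₀ (pow_ne_zero n two_ne_zero) h2)).symm
    refine ⟨h3, ?_⟩
    rw [← h3, h1]
    exact hb'.symm
  refine ⟨m, a, fun n hn => (step n hn ?_).1⟩
  induction n, hn using Nat.le_induction with
  | base => exact ha.symm
  | succ n hn ih => exact (step n hn ih).2

theorem shift_mem_gasket (ω : ℕ → Fin 3) (n : ℕ) : shift ω n ∈ gasket n := by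
  induction n with
  | zero => simp [shift, gasket]
  | succ n ih => exact mem_gasket_succ.2 ⟨_, ih, _, shift_succ ω n⟩

theorem verts_cellsInf_subset (ω : ℕ → Fin 3) : verts (cellsInf ω) ⊆ triLattice := by
  rintro _ ⟨c, hc, a, rfl⟩
  obtain ⟨n, hn⟩ := Set.mem_iUnion.1 hc
  refine add_mem_triLattice ?_ (corner_mem_triLattice a)
  obtain ⟨p, q, h⟩ := gasket_subset n (mem_cells_iff.1 hn)
  obtain ⟨p', q', h'⟩ := gasket_subset n (shift_mem_gasket ω n)
  refine ⟨p - p', q - q', ?_⟩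
  rw [h', ← eq_sub_iff_add_eq] at h
  rw [h]
  simp only [latticePoint]
  push_cast
  ring

/-- The shift determines the first `n` symbols of the blow-up. -/
theorem shift_inj {n : ℕ} {ω ω' : ℕ → Fin 3} (h : shift ω n = shift ω' n) :
    ∀ k < n, ω k = ω' k := by
  induction n generalizing ω ω' with
  | zero => simp
  | succ n ih =>
    have hlow : ∀ ω : ℕ → Fin 3,
        shift ω (n + 1) = 2 * shift (fun k => ω (k + 1)) n + corner (ω 0) := by
      intro ω
      simp only [shift, Finset.sum_range_succ', Finset.mul_sum, pow_succ', pow_zero, one_mul]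
      simp only [mul_assoc]
    have hmem : ∀ (ω : ℕ → Fin 3) n, shift ω n ∈ triLattice := fun ω n =>
      gasket_subset n (shift_mem_gasket ω n)
    have h' : 2 * shift (fun k => ω (k + 1)) n + corner (ω 0) + corner 0 =
        2 * shift (fun k => ω' (k + 1)) n + corner (ω' 0) + corner 0 := by
      rw [← hlow, ← hlow, h]
    have h0 : ω 0 = ω' 0 ∧ shift (fun k => ω (k + 1)) n = shift (fun k => ω' (k + 1)) n := by
      rcases two_mul_add_corner_add_corner (hmem _ _) (hmem _ _) h' with
        ⟨h1, h2, h3⟩ | ⟨h1, h2, ⟨h3, -⟩ | ⟨h3, -⟩⟩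
      · rw [h1, h2] at h3
        exact ⟨h1.trans h2.symm, add_right_cancel h3⟩
      · exact ⟨h3, h2⟩
      · exact absurd h3 h1
    intro k hk
    cases k with
    | zero => exact h0.1
    | succ k => exact ih h0.2 k (by omega)

/-! ### The eigenvalue equation -/

theorem extend_apply {C B : Set ℂ} (f : Vertex C B → ℝ) (x : Vertex C B) :
    extend f x.point = f x := dif_pos x.mem

theorem extend_of_mem {C B : Set ℂ} (f : Vertex C B → ℝ) {z : ℂ} (h : z ∈ verts C ∧ z ∉ B) :
    extend f z = f ⟨z, h⟩ := dif_pos h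

theorem extend_of_notMem {C B : Set ℂ} (f : Vertex C B → ℝ) {z : ℂ} (h : z ∉ verts C) :
    extend f z = 0 := dif_neg fun h' => h h'.1

open Classical in
/-- The difference of the two sides of the eigenvalue equation for `l` at `z`, multiplied by the
number of triangles of `C` containing `z`: the sum over these triangles of
`∑ y, F y - (3 + l) * F z`, with `y` running over the vertices of the triangle. -/
noncomputable def eigenSum (C : Set ℂ) (l : ℝ) (F : ℂ → ℝ) (z : ℂ) : ℝ :=
  ∑ a, if z - corner a ∈ C then ∑ b, F (z - corner a + corner b) - (3 + l) * F z else 0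

theorem ham_apply_eq_iff {C B : Set ℂ} (f : Vertex C B → ℝ) (l : ℝ) (x : Vertex C B) :
    ham C B f x = l * f x ↔ eigenSum C l (extend f) x.point = 0 := by
  classical
  have hm : (mass C x.point : ℝ) ≠ 0 := by
    have := one_le_mass x
    positivity
  have h1 : eigenSum C l (extend f) x.point = -diffOp C B f x - mass C x.point * (l * f x) := by
    simp only [eigenSum, diffOp, mass, extend_apply]
    push_cast
    rw [Finset.sum_mul, ← Finset.sum_neg_distrib, ← Finset.sum_sub_distrib]
    refine Finset.sum_congr rfl fun a _ => ?_
    split_ifs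
    · rw [Finset.sum_sub_distrib]
      simp
      ring
    · simp
  rw [h1]
  change -(1 / (mass C x.point : ℝ)) * diffOp C B f x = _ ↔ _
  constructor
  · intro h
    rw [← h, one_div, neg_mul, mul_neg, mul_inv_cancel_left₀ hm]
    ring
  · intro h
    rw [show diffOp C B f x = -(mass C x.point * (l * f x)) by linarith]
    field_simp

theorem mem_eigenspace_ham_iff {C B : Set ℂ} {f : Vertex C B → ℝ} {l : ℝ} :
    f ∈ Module.End.eigenspace (ham C B) l ↔
      ∀ x : Vertex C B, eigenSum C l (extend f) x.point = 0 := by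
  rw [Module.End.mem_eigenspace_iff, funext_iff]
  exact forall_congr' fun x => ham_apply_eq_iff f l x

theorem eigenSum_congr {C : Set ℂ} {l : ℝ} {F F' : ℂ → ℝ} {z : ℂ} (hz : z ∈ verts C)
    (h : ∀ w ∈ verts C, F w = F' w) : eigenSum C l F z = eigenSum C l F' z := by
  classical
  refine Finset.sum_congr rfl fun a _ => ?_
  split_ifs with ha
  · rw [h z hz]
    congr 1
    exact Finset.sum_congr rfl fun b _ => h _ ⟨_, ha, b, rfl⟩
  · rfl

/-- Translation by `t` of a function on the vertices of `C₀`, extended by `0`. -/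
noncomputable def translate (C B C₀ : Set ℂ) (t : ℂ) :
    (Vertex C₀ ∅ → ℝ) →ₗ[ℝ] (Vertex C B → ℝ) where
  toFun f x := extend f (x.point + t)
  map_add' f g := by funext x; exact extend_add f g _
  map_smul' r f := by funext x; exact extend_smul r f _

/-- A translate of an eigenfunction of the family `C₀` is an eigenfunction of any family `C` that
contains the translated family, provided that it vanishes on the other triangles of `C` and on the
set `B` carrying the Dirichlet condition. -/
theorem translate_mem_eigenspace {C B C₀ : Set ℂ} {t : ℂ} {l : ℝ} {f : Vertex C₀ ∅ → ℝ}
    (hf : f ∈ Module.End.eigenspace (ham C₀ ∅) l) (hC : ∀ c ∈ C₀, c - t ∈ C)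
    (hout : ∀ c ∈ C, c + t ∉ C₀ → ∀ b, extend f (c + corner b + t) = 0)
    (hB : ∀ z ∈ B, extend f (z + t) = 0) :
    translate C B C₀ t f ∈ Module.End.eigenspace (ham C B) l := by
  classical
  rw [mem_eigenspace_ham_iff] at hf ⊢
  intro x
  have hext : ∀ w ∈ verts C, extend (translate C B C₀ t f) w = extend f (w + t) := by
    intro w hw
    by_cases hwB : w ∈ B
    · rw [hB w hwB]
      exact dif_neg fun h => h.2 hwB
    · exact extend_of_mem _ ⟨hw, hwB⟩
  rw [eigenSum_congr (F' := fun w => extend f (w + t)) x.mem.1 hext]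
  have h0 : eigenSum C₀ l (extend f) (x.point + t) = 0 := by
    by_cases hx : x.point + t ∈ verts C₀
    · exact hf ⟨_, hx, by simp⟩
    · refine Finset.sum_eq_zero fun a _ => if_neg fun ha => hx ⟨_, ha, a, by ring⟩
  rw [← h0]
  refine Finset.sum_congr rfl fun a _ => ?_
  have hsub : x.point + t - corner a = x.point - corner a + t := by ring
  by_cases h1 : x.point + t - corner a ∈ C₀
  · have h2 : x.point - corner a ∈ C := by
      have := hC _ h1
      rwa [hsub, add_sub_cancel_right] at this
    rw [if_pos h1, if_pos h2]
    congr 1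
    exact Finset.sum_congr rfl fun b _ => congrArg (extend f) (by ring)
  · rw [if_neg h1]
    split_ifs with h2
    · have h3 := hout _ h2 (by rwa [← hsub])
      have h4 := h3 a
      rw [sub_add_cancel] at h4
      rw [Finset.sum_eq_zero fun b _ => h3 b]
      simp only [h4]
      simp
    · rfl

/-! ### Multiplicities of the Neumann-Dirichlet eigenvalues -/

/-- The Neumann-Dirichlet eigenfunctions of `gasket n` for the eigenvalue `l`: the eigenfunctions
of the Neumann operator which vanish at the three corners. -/
noncomputable def neumannDirichlet (n : ℕ) (l : ℝ) : Submodule ℝ (Vertex (gasket n) ∅ → ℝ) :=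
  Module.End.eigenspace (ham (gasket n) ∅) l ⊓ vanishingOn (gasket n) (gasketBoundary n)

theorem mem_neumannDirichlet_iff {n : ℕ} {l : ℝ} {f : Vertex (gasket n) ∅ → ℝ} :
    f ∈ neumannDirichlet n l ↔
      (∀ x : Vertex (gasket n) ∅, eigenSum (gasket n) l (extend f) x.point = 0) ∧
        ∀ a, extend f (2 ^ n * corner a) = 0 := by
  rw [neumannDirichlet, Submodule.mem_inf, mem_eigenspace_ham_iff]
  refine and_congr_right fun _ => ⟨fun h a => ?_, fun h x hx => ?_⟩
  · have hm : 2 ^ n * corner a ∈ verts (gasket n) := gasketBoundary_subset n ⟨a, rfl⟩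
    rw [extend_of_mem f ⟨hm, by simp⟩]
    exact h _ ⟨a, rfl⟩
  · obtain ⟨a, ha⟩ := hx
    rw [← extend_apply f, ← ha]
    exact h a

theorem extend_eq_zero_of_mem_gasketBoundary {n : ℕ} {l : ℝ} {f : Vertex (gasket n) ∅ → ℝ}
    (hf : f ∈ neumannDirichlet n l) {z : ℂ} (hz : z ∈ gasketBoundary n) : extend f z = 0 := by
  obtain ⟨a, rfl⟩ := hz
  exact (mem_neumannDirichlet_iff.1 hf).2 a

theorem finite_vertex {C : Set ℂ} (B : Set ℂ) (h : (verts C).Finite) : Finite (Vertex C B) := by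
  have := h.to_subtype
  refine Finite.of_injective (fun x : Vertex C B => (⟨x.point, x.mem.1⟩ : verts C)) fun x y hxy => ?_
  exact Vertex.ext (congrArg Subtype.val hxy)

theorem card_vertex_le {C : Set ℂ} (B : Set ℂ) (h : (verts C).Finite) :
    Nat.card (Vertex C B) ≤ (verts C).ncard := by
  have := h.to_subtype
  rw [← Nat.card_coe_set_eq]
  refine Nat.card_le_card_of_injective
    (fun x : Vertex C B => (⟨x.point, x.mem.1⟩ : verts C)) fun x y hxy => ?_
  exact Vertex.ext (congrArg Subtype.val hxy)

theorem card_vertex (C : Set ℂ) : Nat.card (Vertex C ∅) = (verts C).ncard := by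
  rw [← Nat.card_coe_set_eq]
  exact Nat.card_congr ⟨fun x => ⟨x.point, x.mem.1⟩, fun z => ⟨z.1, z.2, by simp⟩, fun _ => rfl,
    fun _ => rfl⟩

theorem finrank_fun_eq_natCard (ι : Type*) [Finite ι] : Module.finrank ℝ (ι → ℝ) = Nat.card ι := by
  have := Fintype.ofFinite ι
  rw [Module.finrank_fintype_fun_eq_card, Nat.card_eq_fintype_card]

instance finite_vertex_gasket (n : ℕ) (B : Set ℂ) : Finite (Vertex (gasket n) B) :=
  finite_vertex B (finite_verts (finite_gasket n))

theorem verts_cells_eq_image (ω : ℕ → Fin 3) (n : ℕ) :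
    verts (cells ω n) = (fun z => z - shift ω n) '' verts (gasket n) := by
  ext z
  rw [mem_verts_cells_iff]
  constructor
  · exact fun h => ⟨_, h, by simp⟩
  · rintro ⟨w, hw, rfl⟩
    simpa using hw

theorem finite_verts_cells (ω : ℕ → Fin 3) (n : ℕ) : (verts (cells ω n)).Finite := by
  rw [verts_cells_eq_image]
  exact (finite_verts (finite_gasket n)).image _

instance finite_vertex_cells (ω : ℕ → Fin 3) (n : ℕ) (B : Set ℂ) : Finite (Vertex (cells ω n) B) :=
  finite_vertex B (finite_verts_cells ω n)

theorem ncard_verts_cells (ω : ℕ → Fin 3) (n : ℕ) :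
    (verts (cells ω n)).ncard = (verts (gasket n)).ncard := by
  rw [verts_cells_eq_image]
  exact Set.ncard_image_of_injective _ fun z w h => by simpa using h

theorem translate_cells_mem {n : ℕ} {l : ℝ} {f : Vertex (gasket n) ∅ → ℝ}
    (hf : f ∈ neumannDirichlet n l) (ω : ℕ → Fin 3) {B : Set ℂ} (hB : B ⊆ boundary ω n) :
    translate (cells ω n) B (gasket n) (shift ω n) f ∈
      Module.End.eigenspace (ham (cells ω n) B) l := by
  refine translate_mem_eigenspace hf.1 (fun c hc => ?_) (fun c hc hn => ?_) fun z hz => ?_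
  · rw [mem_cells_iff]; simpa using hc
  · exact absurd (mem_cells_iff.1 hc) hn
  · exact extend_eq_zero_of_mem_gasketBoundary hf (mem_boundary_iff.1 (hB hz))

theorem translate_cells_injective {n : ℕ} {l : ℝ} (ω : ℕ → Fin 3) {B : Set ℂ}
    (hB : B ⊆ boundary ω n) {f g : Vertex (gasket n) ∅ → ℝ} (hf : f ∈ neumannDirichlet n l)
    (hg : g ∈ neumannDirichlet n l)
    (h : translate (cells ω n) B (gasket n) (shift ω n) f =
      translate (cells ω n) B (gasket n) (shift ω n) g) : f = g := by
  funext x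
  rw [← extend_apply f, ← extend_apply g]
  by_cases hx : x.point - shift ω n ∈ B
  · have hx' := mem_boundary_iff.1 (hB hx)
    rw [sub_add_cancel] at hx'
    rw [extend_eq_zero_of_mem_gasketBoundary hf hx', extend_eq_zero_of_mem_gasketBoundary hg hx']
  · have hv : x.point - shift ω n ∈ verts (cells ω n) := by
      rw [mem_verts_cells_iff, sub_add_cancel]; exact x.mem.1
    have := congrFun h ⟨_, hv, hx⟩
    simpa [translate] using this

theorem finrank_neumannDirichlet_le_eigenspace {n : ℕ} (ω : ℕ → Fin 3) {B : Set ℂ}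
    (hB : B ⊆ boundary ω n) (l : ℝ) :
    Module.finrank ℝ (neumannDirichlet n l) ≤
      Module.finrank ℝ (Module.End.eigenspace (ham (cells ω n) B) l) := by
  refine LinearMap.finrank_le_finrank_of_injective
    (f := (translate (cells ω n) B (gasket n) (shift ω n)).restrict
      fun f hf => translate_cells_mem hf ω hB) fun f g h => ?_
  exact Subtype.ext (translate_cells_injective ω hB f.2 g.2 (congrArg Subtype.val h))

theorem finrank_neumannDirichlet_le_inf (n : ℕ) (ω : ℕ → Fin 3) (l : ℝ) :
    Module.finrank ℝ (neumannDirichlet n l) ≤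
      Module.finrank ℝ ↥(Module.End.eigenspace (ham (cells ω n) ∅) l ⊓
        vanishingOn (cells ω n) (boundary ω n)) := by
  refine LinearMap.finrank_le_finrank_of_injective
    (f := (translate (cells ω n) ∅ (gasket n) (shift ω n)).restrict fun f hf =>
      ⟨translate_cells_mem hf ω (Set.empty_subset _), fun x hx =>
        extend_eq_zero_of_mem_gasketBoundary hf (mem_boundary_iff.1 hx)⟩) fun f g h => ?_
  exact Subtype.ext
    (translate_cells_injective ω (Set.empty_subset _) f.2 g.2 (congrArg Subtype.val h))

/-- A Neumann-Dirichlet eigenfunction of level `n`, extended by `0`, is an eigenfunction on the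
infinite lattice. -/
theorem translate_cellsInf_mem {n : ℕ} {l : ℝ} {f : Vertex (gasket n) ∅ → ℝ}
    (hf : f ∈ neumannDirichlet n l) (ω : ℕ → Fin 3) :
    translate (cellsInf ω) ∅ (gasket n) (shift ω n) f ∈
      Module.End.eigenspace (ham (cellsInf ω) ∅) l := by
  refine translate_mem_eigenspace hf.1 (fun c hc => ?_) (fun c hc hn b => ?_) (by simp)
  · exact Set.mem_iUnion.2 ⟨n, mem_cells_iff.2 (by simpa using hc)⟩
  · by_cases hv : c + corner b ∈ verts (cells ω n)
    · exact extend_eq_zero_of_mem_gasketBoundary hf (mem_boundary_iff.1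
        (mem_boundary_of_not_mem_cells hc (fun h => hn (mem_cells_iff.1 h)) hv))
    · exact extend_of_notMem _ fun h => hv (mem_verts_cells_iff.2 h)

theorem sum_finrank_eq_finrank_biSup {ι M : Type*} [DecidableEq ι] [AddCommGroup M] [Module ℝ M]
    [FiniteDimensional ℝ M] {E : ι → Submodule ℝ M} (hE : iSupIndep E) (s : Finset ι) :
    ∑ i ∈ s, Module.finrank ℝ (E i) = Module.finrank ℝ ↥(⨆ i ∈ s, E i) := by
  induction s using Finset.induction_on with
  | empty =>
    have h : (⨆ i ∈ (∅ : Finset ι), E i) = ⊥ := by simp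
    rw [h, finrank_bot, Finset.sum_empty]
  | insert i s hi ih =>
    have hd : Disjoint (E i) (⨆ j ∈ s, E j) := hE.disjoint_biSup hi
    have h := Submodule.finrank_sup_add_finrank_inf_eq (E i) (⨆ j ∈ s, E j)
    rw [hd.eq_bot, finrank_bot, add_zero] at h
    rw [Finset.sum_insert hi, ih, Finset.iSup_insert, h]

theorem iSupIndep_neumannDirichlet (n : ℕ) : iSupIndep (neumannDirichlet n) :=
  (Module.End.eigenspaces_iSupIndep (ham (gasket n) ∅)).mono fun _ => inf_le_left

/-- The span of all the Neumann-Dirichlet eigenfunctions of level `n`. -/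
noncomputable def neumannDirichletSpan (n : ℕ) : Submodule ℝ (Vertex (gasket n) ∅ → ℝ) :=
  ⨆ l, neumannDirichlet n l

theorem tsum_finrank_neumannDirichlet_le (n : ℕ) :
    ∑' l, (Module.finrank ℝ (neumannDirichlet n l) : ℝ≥0∞) ≤
      Module.finrank ℝ (neumannDirichletSpan n) := by
  classical
  refine ENNReal.summable.tsum_le_of_sum_le fun s => ?_
  rw [← Nat.cast_sum, sum_finrank_eq_finrank_biSup (iSupIndep_neumannDirichlet n)]
  exact Nat.cast_le.2 (Submodule.finrank_mono (iSup₂_le fun l _ => le_iSup _ l))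

theorem tsum_finrank_eigenspace_le {M : Type*} [AddCommGroup M] [Module ℝ M]
    [FiniteDimensional ℝ M] (T : Module.End ℝ M) :
    ∑' l, (Module.finrank ℝ (T.eigenspace l) : ℝ≥0∞) ≤ Module.finrank ℝ M := by
  classical
  refine ENNReal.summable.tsum_le_of_sum_le fun s => ?_
  rw [← Nat.cast_sum, sum_finrank_eq_finrank_biSup T.eigenspaces_iSupIndep]
  exact Nat.cast_le.2 (Submodule.finrank_le _)

theorem tsum_finrank_eigenspace_cells_le (ω : ℕ → Fin 3) (n : ℕ) (B : Set ℂ) :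
    ∑' l, (Module.finrank ℝ (Module.End.eigenspace (ham (cells ω n) B) l) : ℝ≥0∞) ≤
      (verts (gasket n)).ncard := by
  refine (tsum_finrank_eigenspace_le _).trans (Nat.cast_le.2 ?_)
  rw [finrank_fun_eq_natCard, ← ncard_verts_cells ω n]
  exact card_vertex_le B (finite_verts_cells ω n)

/-! ### The eigenvalue equation on a subdivided family -/

theorem two_mul_sub_corner_mem_refined_iff {C : Set ℂ} (hC : C ⊆ triLattice) {u : ℂ}
    (hu : u ∈ triLattice) (e : Fin 3) : 2 * u - corner e ∈ refined C ↔ u - corner e ∈ C := by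
  constructor
  · rintro ⟨c, hc, a, h⟩
    obtain ⟨rfl, rfl⟩ := two_mul_eq hu (hC hc) (a := a) (b := e) (by linear_combination h)
    simpa using hc
  · exact fun h => ⟨_, h, e, by ring⟩

theorem eigenSum_refined_two_mul {C : Set ℂ} (hC : C ⊆ triLattice) {u : ℂ} (hu : u ∈ triLattice)
    (l : ℝ) (F : ℂ → ℝ) [DecidablePred (· ∈ C)] :
    eigenSum (refined C) l F (2 * u) =
      ∑ e, if u - corner e ∈ C then
        ∑ b, F (2 * (u - corner e) + corner e + corner b) - (3 + l) * F (2 * u) else 0 := by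
  classical
  refine Finset.sum_congr rfl fun e _ => ?_
  simp only [two_mul_sub_corner_mem_refined_iff hC hu]
  refine if_congr Iff.rfl ?_ rfl
  congr 1
  exact Finset.sum_congr rfl fun b _ => congrArg F (by ring)

theorem eigenSum_refined_midpoint {C : Set ℂ} (hC : C ⊆ triLattice) {c : ℂ} (hc : c ∈ C)
    {a b : Fin 3} (hab : a ≠ b) (l : ℝ) (F : ℂ → ℝ) :
    eigenSum (refined C) l F (2 * c + corner a + corner b) =
      ∑ d, F (2 * c + corner a + corner d) + ∑ d, F (2 * c + corner b + corner d) -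
        2 * ((3 + l) * F (2 * c + corner a + corner b)) := by
  classical
  have hmem : ∀ e, 2 * c + corner a + corner b - corner e ∈ refined C ↔ e = a ∨ e = b := by
    intro e
    constructor
    · rintro ⟨c', hc', a', h⟩
      have h' : 2 * c + corner a + corner b = 2 * c' + corner a' + corner e := by
        linear_combination h
      rcases two_mul_add_corner_add_corner (hC hc) (hC hc') h' with
        ⟨h1, -⟩ | ⟨-, -, ⟨-, h1⟩ | ⟨h1, -⟩⟩
      · exact absurd h1 hab
      · exact Or.inr h1.symm
      · exact Or.inl h1.symm
    · rintro (rfl | rfl)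
      · exact ⟨c, hc, b, by ring⟩
      · exact ⟨c, hc, a, by ring⟩
  have hterm : ∀ e, (if 2 * c + corner a + corner b - corner e ∈ refined C then
      ∑ d, F (2 * c + corner a + corner b - corner e + corner d) -
        (3 + l) * F (2 * c + corner a + corner b) else 0) =
      (if e = a then ∑ d, F (2 * c + corner b + corner d) -
        (3 + l) * F (2 * c + corner a + corner b) else 0) +
      (if e = b then ∑ d, F (2 * c + corner a + corner d) -
        (3 + l) * F (2 * c + corner a + corner b) else 0) := by
    intro e
    simp only [hmem]
    by_cases h1 : e = a
    · subst h1
      rw [if_pos (Or.inl rfl), if_pos rfl, if_neg hab, add_zero]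
      congr 1
      exact Finset.sum_congr rfl fun d _ => congrArg F (by ring)
    · by_cases h2 : e = b
      · subst h2
        rw [if_pos (Or.inr rfl), if_pos rfl, if_neg h1, zero_add]
        congr 1
        exact Finset.sum_congr rfl fun d _ => congrArg F (by ring)
      · rw [if_neg (by tauto), if_neg h1, if_neg h2, add_zero]
  unfold eigenSum
  rw [Finset.sum_congr rfl fun e _ => hterm e, Finset.sum_add_distrib]
  simp
  ring

/-! ### The eigenvalues `-3` and `-5 / 2` -/

theorem finrank_le_finrank_ker_add {M N : Type*} [AddCommGroup M] [Module ℝ M] [AddCommGroup N]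
    [Module ℝ N] [FiniteDimensional ℝ M] [FiniteDimensional ℝ N] (L : M →ₗ[ℝ] N) :
    Module.finrank ℝ M ≤ Module.finrank ℝ (LinearMap.ker L) + Module.finrank ℝ N := by
  have h1 := L.finrank_range_add_finrank_ker
  have h2 := Submodule.finrank_le (LinearMap.range L)
  omega

/-- Evaluation at `z` of the extension by `0` of a function on the vertices. -/
noncomputable def extendAt {C B : Set ℂ} (z : ℂ) : (Vertex C B → ℝ) →ₗ[ℝ] ℝ where
  toFun f := extend f z
  map_add' f g := extend_add f g z
  map_smul' r f := extend_smul r f z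

/-- A function whose sum over each triangle vanishes is an eigenfunction for the eigenvalue `-3`,
and there are fewer triangles than vertices. -/
theorem three_pow_le_finrank_neg_three (n : ℕ) :
    3 ^ n ≤ 2 * Module.finrank ℝ (neumannDirichlet n (-3)) + 3 := by
  have := (finite_gasket n).to_subtype
  have := Fintype.ofFinite (gasket n)
  let L : (Vertex (gasket n) ∅ → ℝ) →ₗ[ℝ] (gasket n → ℝ) × (Fin 3 → ℝ) :=
    (LinearMap.pi fun c : gasket n => ∑ b, extendAt (c.1 + corner b)).prod
      (LinearMap.pi fun a => extendAt (2 ^ n * corner a))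
  have hker : LinearMap.ker L ≤ neumannDirichlet n (-3) := by
    intro f hf
    obtain ⟨h1, h2⟩ := Prod.ext_iff.1 (LinearMap.mem_ker.1 hf)
    refine mem_neumannDirichlet_iff.2 ⟨fun x => ?_, fun a => congrFun h2 a⟩
    refine Finset.sum_eq_zero fun a _ => ?_
    split_ifs with h
    · have h3 := congrFun h1 ⟨_, h⟩
      have h4 : ∑ b, extend f (x.point - corner a + corner b) = 0 := by
        simpa [L, extendAt] using h3
      rw [h4]
      simp
    · rfl
  have h1 := finrank_le_finrank_ker_add L
  have h2 := Submodule.finrank_mono hker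
  rw [finrank_fun_eq_natCard, card_vertex, Module.finrank_prod, finrank_fun_eq_natCard,
    Nat.card_coe_set_eq, ncard_gasket, Module.finrank_fin_fun] at h1
  have h3 := two_mul_ncard_verts_gasket n
  rw [pow_succ] at h3
  omega

/-- Functions for the eigenvalue `-5 / 2` are obtained by imposing that the old vertices carry the
value `0`, that the values at the three midpoints of each old triangle add up to `0`, and that the
eigenvalue equation holds at the old vertices. -/
theorem three_pow_le_finrank_neg_five_halves (n : ℕ) :
    3 ^ n ≤ 2 * Module.finrank ℝ (neumannDirichlet (n + 1) (-5 / 2)) + 3 := by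
  have := (finite_gasket n).to_subtype
  have := Fintype.ofFinite (gasket n)
  have hmem : ∀ u : Vertex (gasket n) ∅,
      2 * u.point ∈ verts (gasket (n + 1)) ∧ 2 * u.point ∉ (∅ : Set ℂ) := by
    rintro ⟨_, ⟨c, hc, a, rfl⟩, -⟩
    exact ⟨mem_verts_refined.2 ⟨c, hc, a, a, by ring⟩, by simp⟩
  let L : (Vertex (gasket (n + 1)) ∅ → ℝ) →ₗ[ℝ]
      (Vertex (gasket n) ∅ → ℝ) × (gasket n → ℝ) × (Vertex (gasket n) ∅ → ℝ) :=
    (LinearMap.pi fun u => extendAt (2 * u.point)).prod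
      ((LinearMap.pi fun c => ∑ b, extendAt (midpointOpp c.1 b)).prod
        (LinearMap.pi fun u => (LinearMap.proj ⟨2 * u.point, hmem u⟩).comp
          (ham (gasket (n + 1)) ∅)))
  have hker : LinearMap.ker L ≤ neumannDirichlet (n + 1) (-5 / 2) := by
    intro f hf
    obtain ⟨h1, h23⟩ := Prod.ext_iff.1 (LinearMap.mem_ker.1 hf)
    obtain ⟨h2, h3⟩ := Prod.ext_iff.1 h23
    have hold : ∀ c ∈ gasket n, ∀ a, extend f (2 * c + corner a + corner a) = 0 := by
      intro c hc a
      have h4 : extend f (2 * (c + corner a)) = 0 :=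
        congrFun h1 ⟨c + corner a, ⟨c, hc, a, rfl⟩, by simp⟩
      rwa [show 2 * c + corner a + corner a = 2 * (c + corner a) by ring]
    have hmid : ∀ c ∈ gasket n, ∑ b, extend f (midpointOpp c b) = 0 := by
      intro c hc
      have h4 := congrFun h2 ⟨c, hc⟩
      simpa [L, extendAt] using h4
    refine mem_neumannDirichlet_iff.2 ⟨fun x => ?_, fun a => ?_⟩
    · obtain ⟨c, hc, a, b, hx⟩ := mem_verts_refined.1 x.mem.1
      by_cases hab : a = b
      · subst hab
        rw [← ham_apply_eq_iff]
        have hx' : x.point = 2 * (c + corner a) := by rw [hx]; ring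
        have h4 : ham (gasket (n + 1)) ∅ f x = 0 := by
          have h5 := congrFun h3 ⟨c + corner a, ⟨c, hc, a, rfl⟩, by simp⟩
          have h6 : x = ⟨2 * (c + corner a), hx' ▸ x.mem⟩ := Vertex.ext hx'
          rw [h6]
          exact h5
        rw [h4, ← extend_apply f x, hx, hold c hc a, mul_zero]
      · rw [hx]
        refine (eigenSum_refined_midpoint (gasket_subset n) hc hab _ _).trans ?_
        have h0 := hold c hc 0
        have h1 := hold c hc 1
        have h2 := hold c hc 2
        have hm := hmid c hc
        simp only [Fin.sum_univ_three, midpointOpp] at hm ⊢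
        have e1 : ∀ a b, extend f (2 * c + corner a + corner b) =
            extend f (2 * c + corner b + corner a) := fun a b => congrArg _ (by ring)
        have s1 : (2 + 1 : Fin 3) = 0 := by decide
        have s2 : (2 + 2 : Fin 3) = 1 := by decide
        have s3 : (1 + 1 : Fin 3) = 2 := by decide
        have s4 : (1 + 2 : Fin 3) = 0 := by decide
        rw [s1, s2, s3, s4, zero_add, zero_add] at hm
        have e2 := e1 1 0
        have e3 := e1 2 0
        have e4 := e1 2 1
        revert hab
        fin_cases a <;> fin_cases b <;> simp <;> linarith
    · have h4 : extend f (2 * (2 ^ n * corner a)) = 0 :=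
        congrFun h1 ⟨2 ^ n * corner a, gasketBoundary_subset n ⟨a, rfl⟩, by simp⟩
      rwa [pow_succ', mul_assoc]
  have h1 := finrank_le_finrank_ker_add L
  have h2 := Submodule.finrank_mono hker
  rw [finrank_fun_eq_natCard, card_vertex, Module.finrank_prod, Module.finrank_prod,
    finrank_fun_eq_natCard, finrank_fun_eq_natCard, card_vertex,
    Nat.card_coe_set_eq, ncard_gasket] at h1
  have h3 := two_mul_ncard_verts_gasket n
  have h4 := two_mul_ncard_verts_gasket (n + 1)
  rw [pow_succ, pow_succ] at h4
  rw [pow_succ] at h3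
  omega

/-! ### Spectral decimation -/

open Classical in
/-- The value that the decimation extension of `F` takes at the point `2 * c + corner a + corner b`
of the subdivided triangle `c`. At an old vertex this is the value of `F`; at the midpoint of a
side it is the value forced by the eigenvalue equation, for the eigenvalue `l`, at the three
midpoints of the sides of `c`. -/
noncomputable def decimationValue (l : ℝ) (F : ℂ → ℝ) (c : ℂ) (a b : Fin 3) : ℝ :=
  if a = b then F (c + corner a)
  else ((∑ e, F (c + corner e)) / (1 + l) + F (c + corner a) + F (c + corner b)) / (5 + 2 * l)

theorem decimationValue_congr {C : Set ℂ} (hC : C ⊆ triLattice) (l : ℝ) (F : ℂ → ℝ) {c c' : ℂ}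
    (hc : c ∈ C) (hc' : c' ∈ C) {a b a' b' : Fin 3}
    (h : 2 * c + corner a + corner b = 2 * c' + corner a' + corner b') :
    decimationValue l F c a b = decimationValue l F c' a' b' := by
  unfold decimationValue
  rcases two_mul_add_corner_add_corner (hC hc) (hC hc') h with
    ⟨rfl, rfl, h3⟩ | ⟨h1, rfl, ⟨rfl, rfl⟩ | ⟨rfl, rfl⟩⟩
  · rw [if_pos rfl, if_pos rfl, h3]
  · rfl
  · rw [if_neg h1, if_neg (Ne.symm h1)]
    ring

/-- The decimation extension of a function on the vertices of `C` to the vertices of the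
subdivision of `C`. The values are read off any triangle containing the vertex; they do not depend
on the choice, by `decimationValue_congr`. -/
noncomputable def decimationExtension (C : Set ℂ) (l : ℝ) :
    (Vertex C ∅ → ℝ) →ₗ[ℝ] (Vertex (refined C) ∅ → ℝ) where
  toFun g x :=
    let h := mem_verts_refined.1 x.mem.1
    decimationValue l (extend g) h.choose h.choose_spec.2.choose
      h.choose_spec.2.choose_spec.choose
  map_add' f g := by
    funext x
    simp only [decimationValue, Pi.add_apply, extend_add, Finset.sum_add_distrib]
    split_ifs <;> ring
  map_smul' r f := by
    funext x
    simp only [decimationValue, Pi.smul_apply, extend_smul, ← Finset.mul_sum, smul_eq_mul,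
      RingHom.id_apply]
    split_ifs <;> ring

theorem extend_decimationExtension {C : Set ℂ} (hC : C ⊆ triLattice) (l : ℝ) (g : Vertex C ∅ → ℝ)
    {c : ℂ} (hc : c ∈ C) (a b : Fin 3) :
    extend (decimationExtension C l g) (2 * c + corner a + corner b) =
      decimationValue l (extend g) c a b := by
  have hm : 2 * c + corner a + corner b ∈ verts (refined C) := mem_verts_refined.2 ⟨c, hc, a, b, rfl⟩
  rw [extend_of_mem _ ⟨hm, by simp⟩]
  have h := mem_verts_refined.1 hm
  exact decimationValue_congr hC l _ h.choose_spec.1 hc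
    h.choose_spec.2.choose_spec.choose_spec.symm

theorem extend_decimationExtension_two_mul {C : Set ℂ} (hC : C ⊆ triLattice) (l : ℝ)
    (g : Vertex C ∅ → ℝ) {u : ℂ} (hu : u ∈ verts C) :
    extend (decimationExtension C l g) (2 * u) = extend g u := by
  obtain ⟨c, hc, a, rfl⟩ := hu
  rw [show 2 * (c + corner a) = 2 * c + corner a + corner a by ring,
    extend_decimationExtension hC l g hc, decimationValue, if_pos rfl]

theorem decimationExtension_injective {C : Set ℂ} (hC : C ⊆ triLattice) (l : ℝ) :
    Function.Injective (decimationExtension C l) := by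
  intro f g h
  funext x
  rw [← extend_apply f, ← extend_apply g, ← extend_decimationExtension_two_mul hC l f x.mem.1,
    ← extend_decimationExtension_two_mul hC l g x.mem.1, h]

/-- The contribution of one triangle to the eigenvalue equation at an old vertex. -/
theorem decimation_identity_corner {l : ℝ} (h1 : 1 + l ≠ 0) (h5 : 5 + 2 * l ≠ 0) (x y z : ℝ) :
    x + ((x + y + z) / (1 + l) + x + y) / (5 + 2 * l) +
        ((x + y + z) / (1 + l) + x + z) / (5 + 2 * l) - (3 + l) * x =
      (3 + l) / ((1 + l) * (5 + 2 * l)) * (x + y + z - (3 + l * (5 + 2 * l)) * x) := by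
  obtain ⟨w, rfl⟩ : ∃ w, l = (w - 5) / 2 := ⟨5 + 2 * l, by ring⟩
  rw [show 1 + (w - 5) / 2 = (w - 3) / 2 by ring] at *
  rw [show 5 + 2 * ((w - 5) / 2) = w by ring] at *
  have h3 : w - 3 ≠ 0 := fun h => h1 (by rw [h, zero_div])
  field_simp
  ring

/-- The eigenvalue equation at the midpoint of the side joining the corners with values
`x` and `y`. -/
theorem decimation_identity_midpoint {l : ℝ} (h1 : 1 + l ≠ 0) (h5 : 5 + 2 * l ≠ 0) (x y z : ℝ) :
    x + ((x + y + z) / (1 + l) + x + y) / (5 + 2 * l) +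
        ((x + y + z) / (1 + l) + x + z) / (5 + 2 * l) +
      (((x + y + z) / (1 + l) + x + y) / (5 + 2 * l) + y +
        ((x + y + z) / (1 + l) + y + z) / (5 + 2 * l)) -
      2 * ((3 + l) * (((x + y + z) / (1 + l) + x + y) / (5 + 2 * l))) = 0 := by
  obtain ⟨w, rfl⟩ : ∃ w, l = (w - 5) / 2 := ⟨5 + 2 * l, by ring⟩
  rw [show 1 + (w - 5) / 2 = (w - 3) / 2 by ring] at *
  rw [show 5 + 2 * ((w - 5) / 2) = w by ring] at *
  have h3 : w - 3 ≠ 0 := fun h => h1 (by rw [h, zero_div])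
  field_simp
  ring

/-- Spectral decimation: the eigenvalue `pHat l` on a family of triangles gives the eigenvalue `l`
on its subdivision. -/
theorem eigenSum_decimationExtension {C : Set ℂ} (hC : C ⊆ triLattice) {l : ℝ} (h1 : l ≠ -1)
    (h5 : l ≠ -5 / 2) {g : Vertex C ∅ → ℝ}
    (hg : ∀ x : Vertex C ∅, eigenSum C (pHat l) (extend g) x.point = 0)
    (x : Vertex (refined C) ∅) :
    eigenSum (refined C) l (extend (decimationExtension C l g)) x.point = 0 := by
  classical
  have h1' : 1 + l ≠ 0 := fun h => h1 (by linarith)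
  have h5' : 5 + 2 * l ≠ 0 := fun h => h5 (by linarith)
  obtain ⟨c, hc, a, b, hx⟩ := mem_verts_refined.1 x.mem.1
  by_cases hab : a = b
  · subst hab
    have hu : c + corner a ∈ verts C := ⟨c, hc, a, rfl⟩
    rw [hx, show 2 * c + corner a + corner a = 2 * (c + corner a) by ring,
      eigenSum_refined_two_mul hC (verts_subset hC hu),
      extend_decimationExtension_two_mul hC l g hu]
    have hg' := hg ⟨c + corner a, hu, by simp⟩
    refine Eq.trans ?_ ((congrArg ((3 + l) / ((1 + l) * (5 + 2 * l)) * ·) hg').trans (mul_zero _))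
    simp only [eigenSum, Finset.mul_sum]
    refine Finset.sum_congr rfl fun e _ => ?_
    split_ifs with he
    · simp only [extend_decimationExtension hC l g he, decimationValue]
      -- The two sides are compared on each triangle containing the old vertex
      have hval : extend g (c + corner a) = extend g (c + corner a - corner e + corner e) := by
        rw [sub_add_cancel]
      rw [hval]
      generalize c + corner a - corner e = c'
      have key := fun p q r => decimation_identity_corner h1' h5' (extend g (c' + corner p))
        (extend g (c' + corner q)) (extend g (c' + corner r))
      simp only [Fin.sum_univ_three, pHat] at key ⊢
      fin_cases e
      · simp; linear_combination key 0 1 2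
      · simp; linear_combination key 1 0 2
      · simp; linear_combination key 2 0 1
    · rw [mul_zero]
  · rw [hx, eigenSum_refined_midpoint hC hc hab]
    simp only [extend_decimationExtension hC l g hc, decimationValue]
    have key := fun p q r => decimation_identity_midpoint h1' h5' (extend g (c + corner p))
      (extend g (c + corner q)) (extend g (c + corner r))
    simp only [Fin.sum_univ_three]
    revert hab
    fin_cases a <;> fin_cases b <;> intro hab <;> first | exact absurd rfl hab | skip
    · simp; linear_combination key 0 1 2
    · simp; linear_combination key 0 2 1
    · simp; linear_combination key 1 0 2
    · simp; linear_combination key 1 2 0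
    · simp; linear_combination key 2 0 1
    · simp; linear_combination key 2 1 0

/-- The values `l = -1` and `l = -5 / 2`, where the midpoint values are not determined by those at
the old vertices, are excluded. -/
theorem finrank_neumannDirichlet_pHat_le {l : ℝ} (h1 : l ≠ -1) (h5 : l ≠ -5 / 2) (n : ℕ) :
    Module.finrank ℝ (neumannDirichlet n (pHat l)) ≤
      Module.finrank ℝ (neumannDirichlet (n + 1) l) := by
  have hmem : ∀ g ∈ neumannDirichlet n (pHat l),
      decimationExtension (gasket n) l g ∈ neumannDirichlet (n + 1) l := by
    intro g hg
    obtain ⟨hg1, hg2⟩ := mem_neumannDirichlet_iff.1 hg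
    refine mem_neumannDirichlet_iff.2
      ⟨eigenSum_decimationExtension (gasket_subset n) h1 h5 hg1, fun a => ?_⟩
    rw [pow_succ', mul_assoc]
    exact (extend_decimationExtension_two_mul (gasket_subset n) l g
      (gasketBoundary_subset n ⟨a, rfl⟩)).trans (hg2 a)
  refine LinearMap.finrank_le_finrank_of_injective
    (f := (decimationExtension (gasket n) l).restrict hmem) fun f g h => ?_
  exact Subtype.ext (decimationExtension_injective (gasket_subset n) l (congrArg Subtype.val h))

theorem pHat_neg_one : pHat (-1) = -3 := by norm_num [pHat]

theorem pHat_neg_three_halves : pHat (-3 / 2) = -3 := by norm_num [pHat]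

theorem pHat_neg_five_halves : pHat (-5 / 2) = 0 := by norm_num [pHat]

theorem pHat_neg_three : pHat (-3) = 3 := by norm_num [pHat]

theorem pHat_zero : pHat 0 = 0 := by norm_num [pHat]

theorem pHat_iterate_succ_neg_five_halves (k : ℕ) : pHat^[k + 1] (-5 / 2) = 0 := by
  rw [Function.iterate_succ_apply, pHat_neg_five_halves]
  exact Function.iterate_fixed pHat_zero k

theorem pHat_iterate_nonneg {v : ℝ} (hv : 0 ≤ v) (k : ℕ) : 0 ≤ pHat^[k] v := by
  induction k generalizing v with
  | zero => exact hv
  | succ k ih =>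
    rw [Function.iterate_succ_apply]
    exact ih (by unfold pHat; positivity)

/-- The forward orbit of `-3` never meets the negative reals again. -/
theorem pHat_iterate_succ_neg_three_nonneg (k : ℕ) : 0 ≤ pHat^[k + 1] (-3) := by
  rw [Function.iterate_succ_apply, pHat_neg_three]
  exact pHat_iterate_nonneg (by norm_num) k

theorem pHat_iterate_succ_neg_three_halves (k : ℕ) :
    pHat^[k + 1] (-3 / 2) = -3 ∨ 0 ≤ pHat^[k + 1] (-3 / 2) := by
  rw [Function.iterate_succ_apply, pHat_neg_three_halves]
  cases k with
  | zero => exact Or.inl rfl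
  | succ k => exact Or.inr (pHat_iterate_succ_neg_three_nonneg k)

theorem pHat_iterate_succ_neg_one (k : ℕ) :
    pHat^[k + 1] (-1) = -3 ∨ 0 ≤ pHat^[k + 1] (-1) := by
  have h := pHat_iterate_succ_neg_three_halves k
  rwa [Function.iterate_succ_apply, pHat_neg_three_halves, ← pHat_neg_one,
    ← Function.iterate_succ_apply pHat k, pHat_neg_one] at h

/-- Iterated decimation. An orbit of `pHat` ending at a point of `(-3, 0)` does not pass earlier
through the exceptional values `-1` and `-5 / 2`. -/
theorem finrank_neumannDirichlet_iterate_le {l t : ℝ} {k : ℕ} (h : pHat^[k] l = t) (ht : -3 < t)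
    (ht0 : t < 0) (n : ℕ) :
    Module.finrank ℝ (neumannDirichlet n t) ≤
      Module.finrank ℝ (neumannDirichlet (n + k) l) := by
  induction k generalizing l with
  | zero => rw [show t = l from h.symm, add_zero]
  | succ k ih =>
    refine (ih (l := pHat l) h).trans (finrank_neumannDirichlet_pHat_le ?_ ?_ (n + k))
    · rintro rfl
      rcases pHat_iterate_succ_neg_one k with h' | h' <;> linarith
    · rintro rfl
      rw [pHat_iterate_succ_neg_five_halves] at h
      linarith

/-- The eigenvalue `-3 / 2` comes from the eigenvalue `-3` by one decimation step. -/
theorem three_pow_le_finrank_of_neg_three_halves {l : ℝ} {k : ℕ} (h : pHat^[k] l = -3 / 2)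
    (n : ℕ) : 3 ^ n ≤ 2 * Module.finrank ℝ (neumannDirichlet (n + k + 1) l) + 3 := by
  have h1 := finrank_neumannDirichlet_iterate_le h (by norm_num) (by norm_num) (n + 1)
  have h2 := finrank_neumannDirichlet_pHat_le (l := -3 / 2) (by norm_num) (by norm_num) n
  rw [pHat_neg_three_halves] at h2
  have h3 := three_pow_le_finrank_neg_three n
  rw [show n + 1 + k = n + k + 1 by ring] at h1
  omega

theorem three_pow_le_finrank_of_neg_five_halves {l : ℝ} {k : ℕ} (h : pHat^[k] l = -5 / 2)
    (n : ℕ) : 3 ^ n ≤ 2 * Module.finrank ℝ (neumannDirichlet (n + k + 1) l) + 3 := by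
  have h1 := finrank_neumannDirichlet_iterate_le h (by norm_num) (by norm_num) (n + 1)
  have h3 := three_pow_le_finrank_neg_five_halves n
  rw [show n + 1 + k = n + k + 1 by ring] at h1
  omega

/-! ### Convergence of atomic measures from lower bounds and total masses -/

theorem eventually_lt_tsum_mul {ι : Type*} {a : ℕ → ι → ℝ≥0∞} {m : ι → ℝ≥0∞}
    (hlow : ∀ i, ∃ b : ℕ → ℝ≥0∞, Tendsto b atTop (𝓝 (m i)) ∧ ∀ᶠ n in atTop, b n ≤ a n i)
    {g : ι → ℝ≥0∞} (hg : ∀ i, g i ≠ ∞) {c : ℝ≥0∞} (hc : c < ∑' i, m i * g i) :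
    ∀ᶠ n in atTop, c < ∑' i, a n i * g i := by
  rw [ENNReal.tsum_eq_iSup_sum] at hc
  obtain ⟨s, hs⟩ := lt_iSup_iff.1 hc
  choose b hb hba using hlow
  have h1 : Tendsto (fun n => ∑ i ∈ s, b i n * g i) atTop (𝓝 (∑ i ∈ s, m i * g i)) :=
    tendsto_finsetSum s fun i _ => ENNReal.Tendsto.mul_const (hb i) (Or.inr (hg i))
  have h2 : ∀ᶠ n in atTop, ∀ i ∈ s, b i n ≤ a n i :=
    (Finset.eventually_all s).2 fun i _ => hba i
  filter_upwards [h1.eventually_const_lt hs, h2] with n hn hn2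
  refine hn.trans_le ((Finset.sum_le_sum fun i hi => ?_).trans (ENNReal.sum_le_tsum s))
  exact mul_le_mul' (hn2 i hi) le_rfl

/-- If the masses of the atoms are asymptotically bounded below by those of a finite measure, and
the total masses are asymptotically bounded above by its total mass, then the integrals of bounded
functions converge: no mass can escape from an atom without appearing elsewhere. -/
theorem tendsto_tsum_mul {ι : Type*} {a : ℕ → ι → ℝ≥0∞} {m : ι → ℝ≥0∞} {t : ℕ → ℝ≥0∞}
    (hlow : ∀ i, ∃ b : ℕ → ℝ≥0∞, Tendsto b atTop (𝓝 (m i)) ∧ ∀ᶠ n in atTop, b n ≤ a n i)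
    (htot : ∀ n, ∑' i, a n i ≤ t n) (ht : Tendsto t atTop (𝓝 (∑' i, m i)))
    (hfin : ∑' i, m i ≠ ∞) {g : ι → ℝ≥0∞} {M : ℝ≥0∞} (hM : M ≠ ∞) (hg : ∀ i, g i ≤ M) :
    Tendsto (fun n => ∑' i, a n i * g i) atTop (𝓝 (∑' i, m i * g i)) := by
  have hg' : ∀ i, g i ≠ ∞ := fun i => ne_top_of_le_ne_top hM (hg i)
  have hsplit : ∀ f : ι → ℝ≥0∞, ∑' i, f i * g i + ∑' i, f i * (M - g i) = (∑' i, f i) * M := by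
    intro f
    rw [← ENNReal.tsum_add, ← ENNReal.tsum_mul_right]
    refine tsum_congr fun i => ?_
    rw [← mul_add, add_tsub_cancel_of_le (hg i)]
  have hmM : (∑' i, m i) * M ≠ ∞ := ENNReal.mul_ne_top hfin hM
  have hY : ∑' i, m i * (M - g i) ≠ ∞ :=
    ne_top_of_le_ne_top hmM (by rw [← hsplit m]; exact le_add_self)
  have hX : ∑' i, m i * g i ≠ ∞ :=
    ne_top_of_le_ne_top hmM (by rw [← hsplit m]; exact le_self_add)
  refine tendsto_order.2 ⟨fun c hc => eventually_lt_tsum_mul hlow hg' hc, fun c hc => ?_⟩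
  obtain ⟨e, he0, he⟩ : ∃ e : ℝ≥0∞, e ≠ 0 ∧ ∑' i, m i * g i + (e + e) ≤ c := by
    refine ⟨(c - ∑' i, m i * g i) / 2, ?_, ?_⟩
    · rw [Ne, ENNReal.div_eq_zero_iff, not_or]
      exact ⟨(tsub_pos_of_lt hc).ne', by simp⟩
    · rw [ENNReal.add_halves, add_tsub_cancel_of_le hc.le]
  rcases eq_or_ne e ∞ with rfl | hetop
  · -- in this case the bound `c` is infinite
    have hc' : c = ∞ := by simpa using he
    have : Tendsto (fun n => t n * M) atTop (𝓝 ((∑' i, m i) * M)) :=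
      ENNReal.Tendsto.mul_const ht (Or.inr hM)
    filter_upwards [this.eventually_lt_const hmM.lt_top] with n hn
    rw [hc']
    refine lt_of_le_of_lt ?_ hn
    exact (le_self_add.trans (hsplit (a n)).le).trans (mul_le_mul' (htot n) le_rfl)
  have h1 : ∀ᶠ n in atTop, ∑' i, m i * (M - g i) ≤ ∑' i, a n i * (M - g i) + e := by
    rcases eq_or_ne (∑' i, m i * (M - g i)) 0 with h0 | h0
    · exact Eventually.of_forall fun n => by rw [h0]; exact zero_le
    · have hlt : ∑' i, m i * (M - g i) - e < ∑' i, m i * (M - g i) :=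
        ENNReal.sub_lt_self hY h0 he0
      filter_upwards [eventually_lt_tsum_mul hlow
        (fun i => ne_top_of_le_ne_top hM tsub_le_self) hlt] with n hn
      exact tsub_le_iff_right.1 hn.le
  have h2 : ∀ᶠ n in atTop, t n * M < (∑' i, m i) * M + e :=
    (ENNReal.Tendsto.mul_const ht (Or.inr hM)).eventually_lt_const
      (ENNReal.lt_add_right hmM he0)
  filter_upwards [h1, h2] with n hn1 hn2
  have h3 : ∑' i, a n i * g i + ∑' i, m i * (M - g i) <
      ∑' i, m i * g i + (e + e) + ∑' i, m i * (M - g i) := by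
    calc _ ≤ ∑' i, a n i * g i + (∑' i, a n i * (M - g i) + e) := by gcongr
      _ = (∑' i, a n i) * M + e := by rw [← add_assoc, hsplit]
      _ ≤ t n * M + e := by gcongr; exact htot n
      _ < (∑' i, m i) * M + e + e := ENNReal.add_lt_add_right hetop hn2
      _ = _ := by rw [← hsplit m]; ring
  exact (lt_of_add_lt_add_right h3).trans_le he

/-- Convergence of the integrals of bounded nonnegative functions gives weak convergence. -/
theorem tendsto_integral_of_tendsto_lintegral {ν : ℕ → Measure ℝ} [∀ n, IsFiniteMeasure (ν n)]
    {μ : Measure ℝ} [IsFiniteMeasure μ]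
    (h : ∀ (g : ℝ → ℝ≥0∞) (M : ℝ≥0∞), M ≠ ∞ → (∀ l, g l ≤ M) →
      Tendsto (fun n : ℕ => ((3 : ℝ≥0∞) ^ n)⁻¹ * ∫⁻ l, g l ∂ν n) atTop (𝓝 (∫⁻ l, g l ∂μ)))
    (f : ℝ →ᵇ ℝ) :
    Tendsto (fun n : ℕ => (1 / 3 ^ n : ℝ) * ∫ l, f l ∂ν n) atTop (𝓝 (∫ l, f l ∂μ)) := by
  have hb : ∀ f : ℝ →ᵇ ℝ, ∀ l, ENNReal.ofReal (f l) ≤ ENNReal.ofReal ‖f‖ := fun f l =>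
    ENNReal.ofReal_le_ofReal ((le_abs_self _).trans (f.norm_coe_le_norm l))
  have hpart : ∀ f : ℝ →ᵇ ℝ, Tendsto
      (fun n : ℕ => (1 / 3 ^ n : ℝ) * (∫⁻ l, ENNReal.ofReal (f l) ∂ν n).toReal) atTop
      (𝓝 (∫⁻ l, ENNReal.ofReal (f l) ∂μ).toReal) := by
    intro f
    have hne : ∫⁻ l, ENNReal.ofReal (f l) ∂μ ≠ ∞ :=
      ne_top_of_le_ne_top (ENNReal.mul_ne_top ENNReal.ofReal_ne_top (measure_ne_top μ Set.univ))
        ((lintegral_mono (hb f)).trans_eq (lintegral_const _))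
    refine ((ENNReal.tendsto_toReal hne).comp
      (h _ _ ENNReal.ofReal_ne_top (hb f))).congr fun n => ?_
    simp [ENNReal.toReal_mul]
  have hint : ∀ (ν : Measure ℝ) [IsFiniteMeasure ν], ∫ l, f l ∂ν =
      (∫⁻ l, ENNReal.ofReal (f l) ∂ν).toReal - (∫⁻ l, ENNReal.ofReal ((-f) l) ∂ν).toReal := by
    intro ν _
    exact integral_eq_lintegral_pos_part_sub_lintegral_neg_part (f.integrable ν)
  simp only [hint, mul_sub]
  exact (hpart f).sub (hpart (-f))

/-! ### The limit measure -/

theorem pHat_eq_iff {t v : ℝ} (ht : -25 / 8 ≤ t) :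
    pHat v = t ↔ v = (-5 + √(25 + 8 * t)) / 4 ∨ v = (-5 - √(25 + 8 * t)) / 4 := by
  have hs : √(25 + 8 * t) ^ 2 = 25 + 8 * t := Real.sq_sqrt (by linarith)
  set s := √(25 + 8 * t)
  have hfac : pHat v - t = 2 * ((v - (-5 + s) / 4) * (v - (-5 - s) / 4)) := by
    unfold pHat
    linear_combination hs / 8
  rw [← sub_eq_zero, hfac, mul_eq_zero, mul_eq_zero, sub_eq_zero, sub_eq_zero]
  simp

/-- A point of `[-5 / 2, 0]` has two preimages under `pHat`, and both lie in `[-5 / 2, 0]`. -/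
theorem encard_pHat_iterate (k : ℕ) {t : ℝ} (ht : -5 / 2 ≤ t) (ht0 : t ≤ 0) :
    {l | pHat^[k] l = t}.encard = 2 ^ k := by
  induction k generalizing t with
  | zero =>
    have : {l | pHat^[0] l = t} = {t} := by ext; simp
    rw [this, Set.encard_singleton, pow_zero]
  | succ k ih =>
    have hs0 : 0 < √(25 + 8 * t) := Real.sqrt_pos.2 (by linarith)
    have hs5 : √(25 + 8 * t) ≤ 5 := Real.sqrt_le_iff.2 ⟨by norm_num, by linarith⟩
    have hsplit : {l | pHat^[k + 1] l = t} = {l | pHat^[k] l = (-5 + √(25 + 8 * t)) / 4} ∪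
        {l | pHat^[k] l = (-5 - √(25 + 8 * t)) / 4} := by
      ext l
      rw [Set.mem_ofPred_eq, Function.iterate_succ_apply', pHat_eq_iff (by linarith)]
      rfl
    rw [hsplit, Set.encard_union_eq, ih (by linarith) (by linarith),
      ih (by linarith) (by linarith), pow_succ, mul_two]
    rw [Set.disjoint_left]
    intro l h1 h2
    rw [Set.mem_ofPred_eq] at h1 h2
    rw [h1] at h2
    linarith

open Classical in
/-- The mass of the point `l` for the measure `gasketDensity`. -/
noncomputable def gasketMult (l : ℝ) : ℝ≥0∞ :=
  (1 / 2) * (if l = -3 then 1 else 0) + ∑' k : ℕ, ((3 : ℝ≥0∞) ^ (k + 1))⁻¹ / 2 *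
    ((if pHat^[k] l = -3 / 2 then 1 else 0) + if pHat^[k] l = -5 / 2 then 1 else 0)

theorem lintegral_preimageMeasure (k : ℕ) (t : ℝ) (g : ℝ → ℝ≥0∞) [DecidableEq ℝ] :
    ∫⁻ l, g l ∂preimageMeasure k t = ∑' l, (if pHat^[k] l = t then 1 else 0) * g l := by
  rw [preimageMeasure, lintegral_sum_measure]
  simp only [lintegral_dirac]
  refine (tsum_subtype {l | pHat^[k] l = t} g).trans (tsum_congr fun l => ?_)
  by_cases h : pHat^[k] l = t
  · rw [Set.indicator_of_mem (s := {l | pHat^[k] l = t}) h, if_pos h, one_mul]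
  · rw [Set.indicator_of_notMem (s := {l | pHat^[k] l = t}) h, if_neg h, zero_mul]

theorem lintegral_gasketDensity (g : ℝ → ℝ≥0∞) :
    ∫⁻ l, g l ∂gasketDensity = ∑' l, gasketMult l * g l := by
  classical
  simp only [gasketMult, add_mul, ENNReal.tsum_add, ← ENNReal.tsum_mul_right]
  rw [ENNReal.tsum_comm, gasketDensity, lintegral_add_measure, lintegral_smul_measure,
    lintegral_dirac, lintegral_sum_measure, smul_eq_mul]
  congr 1
  · rw [tsum_eq_single (-3)]
    · simp
    · intro l hl
      simp [hl]
  · refine tsum_congr fun k => ?_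
    rw [lintegral_smul_measure, lintegral_add_measure, lintegral_preimageMeasure,
      lintegral_preimageMeasure, smul_eq_mul, ← ENNReal.tsum_add, ← ENNReal.tsum_mul_left]
    refine tsum_congr fun l => ?_
    rw [← add_mul, mul_assoc]

theorem lintegral_multMeasure (d : ℝ → ℕ) (g : ℝ → ℝ≥0∞) :
    ∫⁻ l, g l ∂multMeasure d = ∑' l, (d l : ℝ≥0∞) * g l := by
  simp [multMeasure, lintegral_sum_measure, lintegral_smul_measure, lintegral_dirac]

theorem preimageMeasure_univ (k : ℕ) {t : ℝ} (ht : -5 / 2 ≤ t) (ht0 : t ≤ 0) :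
    preimageMeasure k t Set.univ = 2 ^ k := by
  rw [preimageMeasure, Measure.sum_apply _ MeasurableSet.univ]
  simp only [measure_univ]
  have h := ENNReal.tsum_set_one {l | pHat^[k] l = t}
  rw [encard_pHat_iterate k ht ht0] at h
  refine Eq.trans ?_ (h.trans ?_)
  · rfl
  · simp

/-- The total mass is the limit of `3⁻ⁿ` times the number of vertices of `gasket n`. -/
theorem gasketDensity_univ : gasketDensity Set.univ = 3 / 2 := by
  rw [gasketDensity, Measure.add_apply, Measure.sum_apply _ MeasurableSet.univ]
  simp only [Measure.smul_apply, Measure.add_apply, measure_univ, smul_eq_mul, mul_one]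
  have hterm : ∀ k : ℕ, ((3 : ℝ≥0∞) ^ (k + 1))⁻¹ / 2 *
      (preimageMeasure k (-3 / 2) Set.univ + preimageMeasure k (-5 / 2) Set.univ) =
      3⁻¹ * (2 / 3) ^ k := by
    intro k
    rw [preimageMeasure_univ k (by norm_num) (by norm_num),
      preimageMeasure_univ k (by norm_num) (by norm_num), ← mul_two, pow_succ,
      ENNReal.mul_inv (by simp) (by simp), div_eq_mul_inv, div_eq_mul_inv, mul_pow,
      ENNReal.inv_pow]
    calc _ = (2⁻¹ * 2) * (3⁻¹ * (2 ^ k * 3⁻¹ ^ k) : ℝ≥0∞) := by ring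
      _ = _ := by rw [ENNReal.inv_mul_cancel (by simp) (by simp), one_mul]
  rw [tsum_congr hterm, ENNReal.tsum_mul_left, ENNReal.tsum_geometric]
  have h1 : (1 : ℝ≥0∞) - 2 / 3 = 3⁻¹ := by
    refine ENNReal.sub_eq_of_eq_add (ENNReal.div_ne_top (by simp) (by simp)) ?_
    rw [div_eq_mul_inv, ← one_add_mul, show (1 + 2 : ℝ≥0∞) = 3 by norm_num,
      ENNReal.mul_inv_cancel (by simp) (by simp)]
  rw [h1, inv_inv, ENNReal.inv_mul_cancel (by simp) (by simp)]
  rw [div_eq_mul_inv, div_eq_mul_inv, one_mul, show (3 : ℝ≥0∞) = 1 + 2 by norm_num, add_mul,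
    one_mul, ENNReal.mul_inv_cancel (by simp) (by simp)]

theorem tsum_gasketMult : ∑' l, gasketMult l = 3 / 2 := by
  rw [← gasketDensity_univ, ← lintegral_one, lintegral_gasketDensity]
  simp

/-! ### Asymptotics of the multiplicities -/

theorem tendsto_inv_three_pow : Tendsto (fun n : ℕ => ((3 : ℝ≥0∞) ^ n)⁻¹) atTop (𝓝 0) := by
  simp only [ENNReal.inv_pow]
  exact ENNReal.tendsto_pow_atTop_nhds_zero_of_lt_one (by simp)

theorem exists_tendsto_le_of_three_pow_le {D : ℕ → ℕ} {j : ℕ}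
    (h : ∀ n, 3 ^ n ≤ 2 * D (n + j) + 3) :
    ∃ b : ℕ → ℝ≥0∞, Tendsto b atTop (𝓝 (((3 : ℝ≥0∞) ^ j)⁻¹ / 2)) ∧
      ∀ᶠ n in atTop, b n ≤ ((3 : ℝ≥0∞) ^ n)⁻¹ * D n := by
  have h3 : ∀ n : ℕ, (3 : ℝ≥0∞) ^ n ≠ 0 := fun n => by simp
  have h3' : ∀ n : ℕ, (3 : ℝ≥0∞) ^ n ≠ ∞ := fun n => by simp
  refine ⟨fun n => ((3 : ℝ≥0∞) ^ j)⁻¹ / 2 - ((3 : ℝ≥0∞) ^ n)⁻¹ * (3 / 2), ?_, ?_⟩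
  · have h1 : Tendsto (fun n : ℕ => ((3 : ℝ≥0∞) ^ n)⁻¹ * (3 / 2)) atTop (𝓝 (0 * (3 / 2))) :=
      ENNReal.Tendsto.mul_const tendsto_inv_three_pow
        (Or.inr (ENNReal.div_ne_top (by simp) (by simp)))
    rw [zero_mul] at h1
    have h2 := ENNReal.Tendsto.sub
      (tendsto_const_nhds (x := ((3 : ℝ≥0∞) ^ j)⁻¹ / 2) (f := atTop)) h1 (Or.inr (by simp))
    rwa [tsub_zero] at h2
  · filter_upwards [eventually_ge_atTop j] with N hN
    obtain ⟨n, rfl⟩ := Nat.exists_eq_add_of_le' hN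
    rw [tsub_le_iff_right, ← mul_add]
    have h4 : (3 : ℝ≥0∞) ^ n ≤ 2 * D (n + j) + 3 := by exact_mod_cast h n
    have h5 : ((3 : ℝ≥0∞) ^ j)⁻¹ = ((3 : ℝ≥0∞) ^ (n + j))⁻¹ * 3 ^ n := by
      rw [pow_add, ENNReal.mul_inv (Or.inl (h3 n)) (Or.inl (h3' n)), mul_comm, ← mul_assoc,
        ENNReal.mul_inv_cancel (h3 n) (h3' n), one_mul]
    rw [h5, mul_div_assoc]
    refine mul_le_mul' le_rfl ?_
    rw [ENNReal.div_le_iff (by simp) (by simp), add_mul, ENNReal.div_mul_cancel (by simp) (by simp)]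
    rwa [mul_comm (D (n + j) : ℝ≥0∞)]

theorem pHat_iterate_add_ne {l t : ℝ} {k j : ℕ} (h : pHat^[k] l = t)
    (ht : t = -3 / 2 ∨ t = -5 / 2) :
    pHat^[k + 1 + j] l ≠ -3 / 2 ∧ pHat^[k + 1 + j] l ≠ -5 / 2 := by
  rw [show k + 1 + j = (j + 1) + k by ring, Function.iterate_add_apply, h]
  rcases ht with rfl | rfl
  · rcases pHat_iterate_succ_neg_three_halves j with h | h <;> constructor <;> intro h' <;> linarith
  · rw [pHat_iterate_succ_neg_five_halves]
    constructor <;> norm_num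

theorem pHat_iterate_neg_three_ne (k : ℕ) :
    pHat^[k] (-3) ≠ -3 / 2 ∧ pHat^[k] (-3) ≠ -5 / 2 := by
  cases k with
  | zero => constructor <;> norm_num
  | succ k =>
    have := pHat_iterate_succ_neg_three_nonneg k
    constructor <;> intro h' <;> linarith

theorem gasketMult_neg_three : gasketMult (-3) = 1 / 2 := by
  rw [gasketMult, ENNReal.tsum_eq_zero.2]
  · simp
  · intro k
    rw [if_neg (pHat_iterate_neg_three_ne k).1, if_neg (pHat_iterate_neg_three_ne k).2]
    simp

/-- The forward orbit of `l` meets `{-3 / 2, -5 / 2}` at most once. -/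
theorem gasketMult_of_iterate {l t : ℝ} {k : ℕ} (h : pHat^[k] l = t)
    (ht : t = -3 / 2 ∨ t = -5 / 2) : gasketMult l = ((3 : ℝ≥0∞) ^ (k + 1))⁻¹ / 2 := by
  have hl : l ≠ -3 := by
    rintro rfl
    have := pHat_iterate_neg_three_ne k
    rw [h] at this
    tauto
  rw [gasketMult, if_neg hl, mul_zero, zero_add, tsum_eq_single k]
  · rcases ht with rfl | rfl
    · rw [if_pos h, if_neg (by rw [h]; norm_num)]
      simp
    · rw [if_pos h, if_neg (by rw [h]; norm_num)]
      simp
  · intro k' hk'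
    have hne : pHat^[k'] l ≠ -3 / 2 ∧ pHat^[k'] l ≠ -5 / 2 := by
      rcases lt_or_gt_of_ne hk' with hlt | hlt
      · obtain ⟨j, rfl⟩ := Nat.exists_eq_add_of_le (Nat.succ_le_of_lt hlt)
        constructor <;> intro h'
        · have := pHat_iterate_add_ne (j := j) h' (Or.inl rfl)
          rw [h] at this
          tauto
        · have := pHat_iterate_add_ne (j := j) h' (Or.inr rfl)
          rw [h] at this
          tauto
      · obtain ⟨j, rfl⟩ := Nat.exists_eq_add_of_le (Nat.succ_le_of_lt hlt)
        exact pHat_iterate_add_ne h ht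
    rw [if_neg hne.1, if_neg hne.2]
    simp

/-- The multiplicities of the Neumann-Dirichlet eigenvalues, divided by `3 ^ n`, are asymptotically
at least the masses of `gasketDensity`. -/
theorem exists_tendsto_gasketMult_le (l : ℝ) :
    ∃ b : ℕ → ℝ≥0∞, Tendsto b atTop (𝓝 (gasketMult l)) ∧
      ∀ᶠ n in atTop, b n ≤ ((3 : ℝ≥0∞) ^ n)⁻¹ * Module.finrank ℝ (neumannDirichlet n l) := by
  by_cases h3 : l = -3
  · subst h3
    have h := exists_tendsto_le_of_three_pow_le (j := 0)
      (D := fun n => Module.finrank ℝ (neumannDirichlet n (-3))) three_pow_le_finrank_neg_three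
    rw [gasketMult_neg_three]
    simpa using h
  by_cases h : ∃ k, pHat^[k] l = -3 / 2 ∨ pHat^[k] l = -5 / 2
  · obtain ⟨k, hk⟩ := h
    rw [gasketMult_of_iterate (k := k) rfl hk]
    refine exists_tendsto_le_of_three_pow_le (j := k + 1)
      (D := fun n => Module.finrank ℝ (neumannDirichlet n l)) fun n => ?_
    rcases hk with hk | hk
    · exact three_pow_le_finrank_of_neg_three_halves hk n
    · exact three_pow_le_finrank_of_neg_five_halves hk n
  · have h0 : gasketMult l = 0 := by
      rw [gasketMult, if_neg h3, mul_zero, zero_add, ENNReal.tsum_eq_zero]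
      intro k
      rw [if_neg fun h' => h ⟨k, Or.inl h'⟩, if_neg fun h' => h ⟨k, Or.inr h'⟩]
      simp
    exact ⟨fun _ => 0, by rw [h0]; exact tendsto_const_nhds, Eventually.of_forall fun n => zero_le⟩

theorem tendsto_ncard_verts_gasket :
    Tendsto (fun n : ℕ => ((3 : ℝ≥0∞) ^ n)⁻¹ * (verts (gasket n)).ncard) atTop (𝓝 (3 / 2)) := by
  have h1 : ∀ n : ℕ, ((3 : ℝ≥0∞) ^ n)⁻¹ * (verts (gasket n)).ncard =
      3 / 2 + ((3 : ℝ≥0∞) ^ n)⁻¹ * (3 / 2) := by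
    intro n
    have h2 : (2 : ℝ≥0∞) * (verts (gasket n)).ncard = 3 ^ n * 3 + 3 := by
      have h3 := two_mul_ncard_verts_gasket n
      rw [pow_succ] at h3
      exact_mod_cast h3
    have h4 : ((verts (gasket n)).ncard : ℝ≥0∞) = 3 ^ n * (3 / 2) + 3 / 2 := by
      rw [← mul_div_assoc, ← ENNReal.add_div, ← h2, mul_comm,
        ENNReal.mul_div_cancel_right (by simp) (by simp)]
    rw [h4, mul_add, ← mul_assoc, ENNReal.inv_mul_cancel (by simp) (by simp), one_mul]
  simp only [h1]
  have h5 : Tendsto (fun n : ℕ => 3 / 2 + ((3 : ℝ≥0∞) ^ n)⁻¹ * (3 / 2)) atTop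
      (𝓝 (3 / 2 + 0 * (3 / 2))) :=
    tendsto_const_nhds.add (ENNReal.Tendsto.mul_const tendsto_inv_three_pow
      (Or.inr (ENNReal.div_ne_top (by simp) (by simp))))
  simpa using h5

/-- Any multiplicities which dominate those of the Neumann-Dirichlet eigenvalues and add up to at
most the number of vertices have the limit `gasketDensity`. -/
theorem tendsto_lintegral_multMeasure {d : ℕ → ℝ → ℕ}
    (hlow : ∀ n l, Module.finrank ℝ (neumannDirichlet n l) ≤ d n l)
    (htot : ∀ n, ∑' l, (d n l : ℝ≥0∞) ≤ (verts (gasket n)).ncard)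
    {g : ℝ → ℝ≥0∞} {M : ℝ≥0∞} (hM : M ≠ ∞) (hg : ∀ l, g l ≤ M) :
    Tendsto (fun n : ℕ => ((3 : ℝ≥0∞) ^ n)⁻¹ * ∫⁻ l, g l ∂multMeasure (d n)) atTop
      (𝓝 (∫⁻ l, g l ∂gasketDensity)) := by
  have h := tendsto_tsum_mul (a := fun n l => ((3 : ℝ≥0∞) ^ n)⁻¹ * d n l) (m := gasketMult)
    (t := fun n => ((3 : ℝ≥0∞) ^ n)⁻¹ * (verts (gasket n)).ncard) ?_ ?_ ?_ ?_ hM hg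
  · rw [lintegral_gasketDensity]
    refine h.congr fun n => ?_
    rw [lintegral_multMeasure, ← ENNReal.tsum_mul_left]
    exact tsum_congr fun l => mul_assoc _ _ _
  · intro l
    obtain ⟨b, hb, hb'⟩ := exists_tendsto_gasketMult_le l
    refine ⟨b, hb, hb'.mono fun n hn => hn.trans (mul_le_mul' le_rfl ?_)⟩
    exact Nat.cast_le.2 (hlow n l)
  · intro n
    rw [ENNReal.tsum_mul_left]
    exact mul_le_mul' le_rfl (htot n)
  · rw [tsum_gasketMult]
    exact tendsto_ncard_verts_gasket
  · rw [tsum_gasketMult]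
    exact ENNReal.div_ne_top (by simp) (by simp)

instance isFiniteMeasure_gasketDensity : IsFiniteMeasure gasketDensity :=
  ⟨by rw [gasketDensity_univ]; exact ENNReal.div_lt_top (by simp) (by simp)⟩

theorem isFiniteMeasure_multMeasure {d : ℝ → ℕ} {N : ℕ} (h : ∑' l, (d l : ℝ≥0∞) ≤ N) :
    IsFiniteMeasure (multMeasure d) := by
  refine ⟨?_⟩
  rw [← lintegral_one, lintegral_multMeasure]
  simp only [mul_one]
  exact h.trans_lt (ENNReal.natCast_lt_top N)

theorem isDensityOfStates_gasketDensity (ω : ℕ → Fin 3) : IsDensityOfStates ω gasketDensity := by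
  have h1 : ∀ n, IsFiniteMeasure (nuPlus ω n) := fun n =>
    isFiniteMeasure_multMeasure (tsum_finrank_eigenspace_cells_le ω n ∅)
  have h2 : ∀ n, IsFiniteMeasure (nuMinus ω n) := fun n =>
    isFiniteMeasure_multMeasure (tsum_finrank_eigenspace_cells_le ω n (boundary ω n))
  refine ⟨inferInstance, fun f => ⟨?_, ?_⟩⟩
  · refine tendsto_integral_of_tendsto_lintegral (fun g M hM hg => ?_) f
    exact tendsto_lintegral_multMeasure
      (fun n l => finrank_neumannDirichlet_le_eigenspace ω (Set.empty_subset _) l)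
      (fun n => tsum_finrank_eigenspace_cells_le ω n ∅) hM hg
  · refine tendsto_integral_of_tendsto_lintegral (fun g M hM hg => ?_) f
    exact tendsto_lintegral_multMeasure
      (fun n l => finrank_neumannDirichlet_le_eigenspace ω subset_rfl l)
      (fun n => tsum_finrank_eigenspace_cells_le ω n (boundary ω n)) hM hg

theorem isNDDensity_gasketDensity (ω : ℕ → Fin 3) : IsNDDensity ω gasketDensity := by
  intro s hs
  have h := tendsto_lintegral_multMeasure (fun n l => finrank_neumannDirichlet_le_inf n ω l)
    (fun n => (ENNReal.tsum_le_tsum fun l =>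
      Nat.cast_le.2 (Submodule.finrank_mono inf_le_left)).trans
        (tsum_finrank_eigenspace_cells_le ω n ∅))
    (g := s.indicator 1) (M := 1) (by simp) (fun l => Set.indicator_le_self' (by simp) l)
  simp only [lintegral_indicator_one hs] at h
  exact h

/-- The Neumann-Dirichlet eigenfunctions span asymptotically the whole space. -/
theorem tendsto_codim_neumannDirichletSpan :
    Tendsto (fun n : ℕ => ((3 : ℝ≥0∞) ^ n)⁻¹ *
      ((verts (gasket n)).ncard - Module.finrank ℝ (neumannDirichletSpan n) : ℝ≥0∞))
      atTop (𝓝 0) := by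
  have hle : ∀ n, (Module.finrank ℝ (neumannDirichletSpan n) : ℝ≥0∞) ≤
      (verts (gasket n)).ncard := by
    intro n
    rw [← card_vertex, ← finrank_fun_eq_natCard]
    exact Nat.cast_le.2 (Submodule.finrank_le _)
  have h := tendsto_lintegral_multMeasure (g := 1) (M := 1)
    (d := fun n l => Module.finrank ℝ (neumannDirichlet n l)) (fun n l => le_rfl)
    (fun n => (tsum_finrank_neumannDirichlet_le n).trans (hle n)) (by simp) (by simp)
  simp only [Pi.one_apply, lintegral_one, gasketDensity_univ] at h
  have h2 := ENNReal.Tendsto.sub tendsto_ncard_verts_gasket h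
    (Or.inl (ENNReal.div_ne_top (by simp) (by simp)))
  rw [tsub_self] at h2
  refine tendsto_of_tendsto_of_tendsto_of_le_of_le tendsto_const_nhds h2
    (fun n => zero_le) fun n => ?_
  simp only
  rw [ENNReal.mul_sub (by simp)]
  refine tsub_le_tsub_left (mul_le_mul' le_rfl ?_) _
  rw [← lintegral_one, lintegral_multMeasure]
  simpa using tsum_finrank_neumannDirichlet_le n

/-! ### Functions with finite support in `L²` -/

theorem memLp_of_finite_support {C B : Set ℂ} {f : Vertex C B → ℝ}
    (h : (Function.support f).Finite) : MemLp f 2 (massMeasure C B) := by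
  refine ⟨aestronglyMeasurable_vertex f, ?_⟩
  rw [eLpNorm_two_eq, lintegral_massMeasure, tsum_eq_sum (s := h.toFinset)]
  · refine ENNReal.rpow_lt_top_of_nonneg (by norm_num) (ENNReal.sum_ne_top.2 fun x _ => ?_)
    exact ENNReal.mul_ne_top (by simp) ENNReal.ofReal_ne_top
  · intro x hx
    have : f x = 0 := by simpa using hx
    simp [this]

theorem massMeasure_real_singleton {C B : Set ℂ} (x : Vertex C B) :
    (massMeasure C B).real {x} = mass C x.point := by
  have h : massMeasure C B {x} = mass C x.point := by
    rw [← lintegral_indicator_one (MeasurableSet.of_discrete), lintegral_massMeasure,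
      tsum_eq_single x]
    · simp
    · intro y hy
      simp [hy]
  rw [Measure.real, h]
  simp

theorem inner_eq_sum {C B : Set ℂ} (f g : L2 C B) (s : Finset (Vertex C B))
    (hf : ∀ x ∉ s, f x = 0) : inner ℝ f g = ∑ x ∈ s, mass C x.point * (f x * g x) := by
  have hs : massMeasure C B s ≠ ∞ := by
    rw [← lintegral_indicator_one (MeasurableSet.of_discrete), lintegral_massMeasure,
      tsum_eq_sum (s := s)]
    · exact ENNReal.sum_ne_top.2 fun x _ => ENNReal.mul_ne_top (by simp) (by
        by_cases h : x ∈ (s : Set (Vertex C B)) <;> simp [h])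
    · intro x hx
      simp [hx]
  rw [L2.inner_def, ← setIntegral_eq_integral_of_forall_compl_eq_zero (s := (s : Set (Vertex C B)))
    (fun x hx => by rw [hf x hx]; simp), setIntegral_finset]
  · refine Finset.sum_congr rfl fun x _ => ?_
    rw [massMeasure_real_singleton, smul_eq_mul]
    simp [mul_comm]
  · exact (L2.integrable_inner (𝕜 := ℝ) f g).integrableOn

theorem coe_hamL2 {C B : Set ℂ} (f : L2 C B) : (hamL2 C B f : Vertex C B → ℝ) = ham C B f :=
  eq_of_ae_eq (MemLp.coeFn_toLp (memLp_ham (Lp.memLp f)))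

theorem coe_toLp {C B : Set ℂ} {f : Vertex C B → ℝ} (h : MemLp f 2 (massMeasure C B)) :
    (h.toLp f : Vertex C B → ℝ) = f := eq_of_ae_eq h.coeFn_toLp

theorem coe_smul_L2 {C B : Set ℂ} (r : ℝ) (f : L2 C B) :
    ((r • f : L2 C B) : Vertex C B → ℝ) = r • (f : Vertex C B → ℝ) :=
  eq_of_ae_eq (Lp.coeFn_smul r f)

theorem coe_sub_L2 {C B : Set ℂ} (f g : L2 C B) :
    ((f - g : L2 C B) : Vertex C B → ℝ) = (f : Vertex C B → ℝ) - g :=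
  eq_of_ae_eq (Lp.coeFn_sub f g)

theorem coe_add_L2 {C B : Set ℂ} (f g : L2 C B) :
    ((f + g : L2 C B) : Vertex C B → ℝ) = (f : Vertex C B → ℝ) + g :=
  eq_of_ae_eq (Lp.coeFn_add f g)

theorem coe_zero_L2 {C B : Set ℂ} : ((0 : L2 C B) : Vertex C B → ℝ) = 0 :=
  eq_of_ae_eq (Lp.coeFn_zero ℝ 2 (massMeasure C B))

theorem ext_L2 {C B : Set ℂ} {f g : L2 C B} (h : (f : Vertex C B → ℝ) = g) : f = g :=
  Lp.ext (Eventually.of_forall fun x => congrFun h x)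

open Classical in
/-- The kernel of the operator `mass * ham`. -/
noncomputable def hamKernel {C B : Set ℂ} (x y : Vertex C B) : ℝ :=
  ∑ a, ∑ b, (if x.point - corner a ∈ C ∧ x.point - corner a = y.point - corner b then 1 else 0) -
    if x = y then 3 * (mass C x.point : ℝ) else 0

theorem hamKernel_comm {C B : Set ℂ} (x y : Vertex C B) : hamKernel x y = hamKernel y x := by
  classical
  unfold hamKernel
  rw [Finset.sum_comm]
  congr 1
  · refine Finset.sum_congr rfl fun b _ => Finset.sum_congr rfl fun a _ => ?_
    refine if_congr ⟨fun h => ?_, fun h => ?_⟩ rfl rfl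
    · exact ⟨h.2 ▸ h.1, h.2.symm⟩
    · exact ⟨h.2 ▸ h.1, h.2.symm⟩
  · by_cases h : x = y
    · rw [h]
    · rw [if_neg h, if_neg (Ne.symm h)]

theorem extend_eq_sum {C B : Set ℂ} {f : Vertex C B → ℝ} {s : Finset (Vertex C B)}
    (hf : ∀ x ∉ s, f x = 0) (z : ℂ) [DecidableEq ℂ] :
    extend f z = ∑ y ∈ s, (if z = y.point then 1 else 0) * f y := by
  by_cases hz : z ∈ verts C ∧ z ∉ B
  · rw [extend_of_mem f hz]
    by_cases hs : (⟨z, hz⟩ : Vertex C B) ∈ s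
    · rw [Finset.sum_eq_single_of_mem _ hs, if_pos rfl, one_mul]
      intro y _ hy
      rw [if_neg, zero_mul]
      exact fun h => hy (Vertex.ext h.symm)
    · rw [hf _ hs, Finset.sum_eq_zero]
      intro y hy
      rw [if_neg, zero_mul]
      rintro rfl
      exact hs hy
  · rw [show extend f z = 0 from dif_neg hz, Finset.sum_eq_zero]
    intro y _
    rw [if_neg, zero_mul]
    rintro rfl
    exact hz y.mem

theorem mass_mul_ham_eq_sum {C B : Set ℂ} {f : Vertex C B → ℝ} {s : Finset (Vertex C B)}
    (hf : ∀ x ∉ s, f x = 0) (x : Vertex C B) :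
    mass C x.point * ham C B f x = ∑ y ∈ s, hamKernel x y * f y := by
  classical
  have hm : (mass C x.point : ℝ) ≠ 0 := by
    have := one_le_mass x
    positivity
  have h1 : mass C x.point * ham C B f x = -diffOp C B f x := by
    change (mass C x.point : ℝ) * (-(1 / (mass C x.point : ℝ)) * diffOp C B f x) = _
    field_simp
  have h2 : f x = ∑ y ∈ s, (if x = y then 1 else 0) * f y := by
    rw [← extend_apply f x, extend_eq_sum hf]
    refine Finset.sum_congr rfl fun y _ => ?_
    congr 1
    exact if_congr ⟨fun h => Vertex.ext h, fun h => by rw [h]⟩ rfl rfl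
  have h3 : -diffOp C B f x = ∑ a, (if x.point - corner a ∈ C then
      ∑ b, extend f (x.point - corner a + corner b) else 0) - 3 * mass C x.point * f x := by
    simp only [diffOp, mass]
    push_cast
    rw [Finset.mul_sum, Finset.sum_mul, ← Finset.sum_neg_distrib, ← Finset.sum_sub_distrib]
    refine Finset.sum_congr rfl fun a _ => ?_
    split_ifs
    · rw [Finset.sum_sub_distrib]
      simp
    · simp
  rw [h1, h3]
  simp only [hamKernel, sub_mul, Finset.sum_sub_distrib]
  congr 1
  · simp only [Finset.sum_mul]
    rw [Finset.sum_comm]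
    refine Finset.sum_congr rfl fun a _ => ?_
    rw [Finset.sum_comm]
    split_ifs with ha
    · refine Finset.sum_congr rfl fun b _ => ?_
      rw [extend_eq_sum hf]
      refine Finset.sum_congr rfl fun y _ => ?_
      congr 1
      exact if_congr ⟨fun h => ⟨ha, by rw [← h]; ring⟩, fun h => by rw [h.2]; ring⟩ rfl rfl
    · symm
      refine Finset.sum_eq_zero fun b _ => Finset.sum_eq_zero fun y _ => ?_
      rw [if_neg fun h => ha h.1, zero_mul]
  · rw [h2, Finset.mul_sum]
    refine Finset.sum_congr rfl fun y _ => ?_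
    split_ifs <;> ring

/-- Symmetry of the operator, on functions with finite support. -/
theorem inner_hamL2_comm {C B : Set ℂ} (f g : L2 C B) (hf : {x | f x ≠ 0}.Finite)
    (hg : {x | g x ≠ 0}.Finite) : inner ℝ (hamL2 C B f) g = inner ℝ f (hamL2 C B g) := by
  classical
  set s := hf.toFinset ∪ hg.toFinset with hs
  have hf' : ∀ x ∉ s, f x = 0 := fun x hx => by
    by_contra h
    exact hx (Finset.mem_union_left _ (hf.mem_toFinset.2 h))
  have hg' : ∀ x ∉ s, g x = 0 := fun x hx => by
    by_contra h
    exact hx (Finset.mem_union_right _ (hg.mem_toFinset.2 h))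
  rw [real_inner_comm, inner_eq_sum g _ s hg', inner_eq_sum f _ s hf', coe_hamL2, coe_hamL2]
  have h1 : ∀ x ∈ s, mass C x.point * (g x * ham C B f x) =
      ∑ y ∈ s, g x * (hamKernel x y * f y) := by
    intro x _
    rw [mul_left_comm, mass_mul_ham_eq_sum hf', Finset.mul_sum]
  have h2 : ∀ x ∈ s, mass C x.point * (f x * ham C B g x) =
      ∑ y ∈ s, f x * (hamKernel x y * g y) := by
    intro x _
    rw [mul_left_comm, mass_mul_ham_eq_sum hg', Finset.mul_sum]
  rw [Finset.sum_congr rfl h1, Finset.sum_congr rfl h2, Finset.sum_comm]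
  refine Finset.sum_congr rfl fun x _ => Finset.sum_congr rfl fun y _ => ?_
  rw [hamKernel_comm]
  ring

theorem inner_eq_zero_of_eigenvalue_ne {C B : Set ℂ} {f g : L2 C B} (hf : {x | f x ≠ 0}.Finite)
    (hg : {x | g x ≠ 0}.Finite) {l l' : ℝ} (hl : l ≠ l') (hfl : hamL2 C B f = l • f)
    (hgl : hamL2 C B g = l' • g) : inner ℝ f g = 0 := by
  have h := inner_hamL2_comm f g hf hg
  rw [hfl, hgl, real_inner_smul_left, real_inner_smul_right] at h
  have h' : (l - l') * inner ℝ f g = 0 := by rw [sub_mul, h, sub_self]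
  exact (mul_eq_zero.1 h').resolve_left (sub_ne_zero.2 hl)

theorem finite_support_smul {C B : Set ℂ} {f : L2 C B} (hf : {x | f x ≠ 0}.Finite) (r : ℝ) :
    {x | (r • f : L2 C B) x ≠ 0}.Finite := by
  refine hf.subset fun x hx h => hx ?_
  rw [coe_smul_L2, Pi.smul_apply, h, smul_zero]

theorem finite_support_sub {C B : Set ℂ} {f g : L2 C B} (hf : {x | f x ≠ 0}.Finite)
    (hg : {x | g x ≠ 0}.Finite) : {x | (f - g : L2 C B) x ≠ 0}.Finite := by
  refine (hf.union hg).subset fun x hx => ?_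
  by_contra h
  rw [Set.mem_union, not_or] at h
  have h1 : f x = 0 := not_not.1 h.1
  have h2 : g x = 0 := not_not.1 h.2
  refine hx ?_
  rw [coe_sub_L2, Pi.sub_apply, h1, h2, sub_zero]

theorem finite_support_sum {C B : Set ℂ} {ι : Type*} (s : Finset ι) {f : ι → L2 C B}
    (hf : ∀ i ∈ s, {x | f i x ≠ 0}.Finite) : {x | (∑ i ∈ s, f i : L2 C B) x ≠ 0}.Finite := by
  classical
  induction s using Finset.induction_on with
  | empty =>
    rw [Finset.sum_empty, coe_zero_L2]
    simp
  | insert i s hi ih =>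
    rw [Finset.sum_insert hi]
    have h1 := hf i (Finset.mem_insert_self i s)
    have h2 := ih fun j hj => hf j (Finset.mem_insert_of_mem hj)
    refine (h1.union h2).subset fun x hx => ?_
    by_contra h
    rw [Set.mem_union, not_or] at h
    have h3 : f i x = 0 := not_not.1 h.1
    have h4 : (∑ i ∈ s, f i : L2 C B) x = 0 := not_not.1 h.2
    refine hx ?_
    rw [coe_add_L2, Pi.add_apply, h3, h4, add_zero]

/-! ### Hilbert bases of eigenfunctions -/

/-- The Gram-Schmidt process keeps eigenfunctions with finite support: eigenfunctions for different
eigenvalues are orthogonal, so only those with the same eigenvalue are subtracted. -/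
theorem gramSchmidt_eigenfunction {C B : Set ℂ} {v : ℕ → L2 C B} {l : ℕ → ℝ}
    (hv : ∀ n, hamL2 C B (v n) = l n • v n) (hfin : ∀ n, {x | v n x ≠ 0}.Finite) (n : ℕ) :
    hamL2 C B (InnerProductSpace.gramSchmidt ℝ v n) =
      l n • InnerProductSpace.gramSchmidt ℝ v n ∧
      {x | InnerProductSpace.gramSchmidt ℝ v n x ≠ 0}.Finite := by
  induction n using Nat.strong_induction_on with
  | _ n ih =>
    have hdef : InnerProductSpace.gramSchmidt ℝ v n = v n - ∑ i ∈ Finset.Iio n,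
        (inner ℝ (InnerProductSpace.gramSchmidt ℝ v i) (v n) /
          ‖InnerProductSpace.gramSchmidt ℝ v i‖ ^ 2) • InnerProductSpace.gramSchmidt ℝ v i :=
      eq_sub_of_add_eq (InnerProductSpace.gramSchmidt_def'' ℝ v n).symm
    constructor
    · rw [hdef, map_sub, map_sum, hv, smul_sub, Finset.smul_sum]
      congr 1
      refine Finset.sum_congr rfl fun i hi => ?_
      obtain ⟨h1, h2⟩ := ih i (Finset.mem_Iio.1 hi)
      rw [map_smul, h1, smul_comm]
      by_cases hl : l i = l n
      · rw [hl]
      · rw [inner_eq_zero_of_eigenvalue_ne h2 (hfin n) hl h1 (hv n), zero_div, zero_smul,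
          smul_zero, smul_zero]
    · rw [hdef]
      exact finite_support_sub (hfin n) (finite_support_sum _ fun i hi =>
        finite_support_smul (ih i (Finset.mem_Iio.1 hi)).2 _)

theorem purePoint_of_span_dense {C B : Set ℂ} {v : ℕ → L2 C B} {l : ℕ → ℝ}
    (hv : ∀ n, hamL2 C B (v n) = l n • v n) (hfin : ∀ n, {x | v n x ≠ 0}.Finite)
    (hdense : (Submodule.span ℝ (Set.range v))ᗮ = ⊥) : PurePointWithCompactSupport C B := by
  have hspan : Submodule.span ℝ (Set.range
      fun i : {i | InnerProductSpace.gramSchmidtNormed ℝ v i ≠ 0} =>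
        InnerProductSpace.gramSchmidtNormed ℝ v i) = Submodule.span ℝ (Set.range v) := by
    rw [← InnerProductSpace.span_gramSchmidt ℝ v,
      ← InnerProductSpace.span_gramSchmidtNormed_range v]
    refine le_antisymm (Submodule.span_mono ?_) (Submodule.span_le.2 ?_)
    · rintro _ ⟨i, rfl⟩
      exact ⟨i, rfl⟩
    · rintro _ ⟨i, rfl⟩
      by_cases h : InnerProductSpace.gramSchmidtNormed ℝ v i = 0
      · rw [h]
        exact Submodule.zero_mem _
      · exact Submodule.subset_span ⟨⟨i, h⟩, rfl⟩
  refine ⟨_, HilbertBasis.mkOfOrthogonalEqBot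
    (InnerProductSpace.gramSchmidtNormed_orthonormal' v) (by rw [hspan, hdense]), fun i => ?_⟩
  rw [HilbertBasis.coe_mkOfOrthogonalEqBot]
  obtain ⟨h1, h2⟩ := gramSchmidt_eigenfunction hv hfin i
  refine ⟨⟨l i, ?_⟩, finite_support_smul h2 _⟩
  rw [InnerProductSpace.gramSchmidtNormed, map_smul, h1, smul_comm]

open Classical in
/-- The indicator function of a vertex, as an element of `L²`. -/
noncomputable def deltaL2 {C B : Set ℂ} (x : Vertex C B) : L2 C B :=
  (memLp_of_finite_support (f := Pi.single x 1)
    ((Set.finite_singleton x).subset (Pi.support_single_subset))).toLp _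

theorem inner_deltaL2 {C B : Set ℂ} (x : Vertex C B) (f : L2 C B) :
    inner ℝ (deltaL2 x) f = mass C x.point * f x := by
  classical
  rw [inner_eq_sum _ _ {x}, Finset.sum_singleton, deltaL2, coe_toLp, Pi.single_eq_same, one_mul]
  intro y hy
  rw [deltaL2, coe_toLp, Pi.single_eq_of_ne (by simpa using hy)]

/-- A subspace that approximates the indicator functions of all vertices is dense. -/
theorem orthogonal_eq_bot_of_deltaL2 {C B : Set ℂ} {S : Submodule ℝ (L2 C B)}
    (h : ∀ (x : Vertex C B) (e : ℝ), 0 < e → ∃ F ∈ S, ‖deltaL2 x - F‖ ≤ e) : Sᗮ = ⊥ := by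
  rw [Submodule.eq_bot_iff]
  intro f hf
  refine ext_L2 (funext fun x => ?_)
  rw [coe_zero_L2, Pi.zero_apply]
  have hm : (mass C x.point : ℝ) ≠ 0 := by
    have := one_le_mass x
    positivity
  have h0 : inner ℝ (deltaL2 x) f = (0 : ℝ) := by
    rw [← abs_nonpos_iff]
    refine le_of_forall_pos_le_add fun e he => ?_
    obtain ⟨F, hF, hle⟩ := h x (e / (‖f‖ + 1)) (by positivity)
    have h1 : inner ℝ (deltaL2 x) f = inner ℝ (deltaL2 x - F) f := by
      rw [inner_sub_left, Submodule.inner_right_of_mem_orthogonal hF hf, sub_zero]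
    rw [h1, zero_add]
    refine (abs_real_inner_le_norm _ _).trans ?_
    calc ‖deltaL2 x - F‖ * ‖f‖ ≤ e / (‖f‖ + 1) * (‖f‖ + 1) := by
          gcongr
          linarith
      _ = e := by field_simp
  rw [inner_deltaL2] at h0
  exact (mul_eq_zero.1 h0).resolve_left hm

/-! ### Distances to a subspace -/

/-- The squared distances of the vectors of the canonical basis to a subspace add up to the
codimension of the subspace. This is the trace of the orthogonal projection. -/
theorem exists_sq_dist_sum_eq {ι : Type*} [Fintype ι] [DecidableEq ι] (V : Submodule ℝ (ι → ℝ)) :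
    ∃ δ : ι → ℝ, (∀ i, 0 ≤ δ i) ∧
      ∑ i, δ i = Fintype.card ι - Module.finrank ℝ V ∧
      ∀ i, ∃ F ∈ V, ∑ j, ((Pi.single i 1 : ι → ℝ) - F) j ^ 2 = δ i := by
  let e := WithLp.linearEquiv 2 ℝ (ι → ℝ)
  let W : Submodule ℝ (EuclideanSpace ℝ ι) := V.comap e.toLinearMap
  let b := EuclideanSpace.basisFun ι ℝ
  have hW : Module.finrank ℝ W = Module.finrank ℝ V := by
    have : W = V.map e.symm.toLinearMap := (Submodule.map_equiv_eq_comap_symm e.symm V).symm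
    rw [this]
    exact LinearEquiv.finrank_map_eq e.symm V
  have hproj : LinearMap.IsProj W (W.starProjection : EuclideanSpace ℝ ι →ₗ[ℝ] _) :=
    ⟨fun x => W.starProjection_apply_mem x, fun x hx => W.starProjection_eq_self_iff.2 hx⟩
  have htr := hproj.trace
  rw [LinearMap.trace_eq_sum_inner _ b, hW] at htr
  have hdist : ∀ i, ‖b i - W.starProjection (b i)‖ ^ 2 =
      1 - inner ℝ (b i) (W.starProjection (b i)) := by
    intro i
    have h1 := W.starProjection_inner_eq_zero (b i) (W.starProjection (b i))
      (W.starProjection_apply_mem _)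
    rw [← real_inner_self_eq_norm_sq, inner_sub_right, h1, sub_zero, inner_sub_left,
      real_inner_self_eq_norm_sq, b.norm_eq_one, real_inner_comm]
    norm_num
  refine ⟨fun i => ‖b i - W.starProjection (b i)‖ ^ 2, fun i => sq_nonneg _, ?_, fun i => ?_⟩
  · rw [Finset.sum_congr rfl fun i _ => hdist i, Finset.sum_sub_distrib]
    congr 1
    · simp
  · refine ⟨e (W.starProjection (b i)), W.starProjection_apply_mem (b i), ?_⟩
    refine Eq.trans ?_ (EuclideanSpace.real_norm_sq_eq _).symm
    refine Finset.sum_congr rfl fun j _ => ?_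
    simp [e, b, EuclideanSpace.basisFun_apply, Pi.single_apply]

/-! ### Random blow-ups -/

theorem blowUpLaw_pi (s : Finset ℕ) (w : ℕ → Fin 3) :
    blowUpLaw {ω | ∀ k ∈ s, ω k = w k} = ((3 : ℝ≥0∞) ^ s.card)⁻¹ := by
  have h : {ω : ℕ → Fin 3 | ∀ k ∈ s, ω k = w k} = Set.pi s fun k => {w k} := by
    ext ω
    simp
  rw [h, blowUpLaw, Measure.infinitePi_pi _ fun _ _ => MeasurableSet.of_discrete]
  simp [ENNReal.inv_pow]

theorem blowUpLaw_shift_le (n : ℕ) (z : ℂ) :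
    blowUpLaw {ω | shift ω n = z} ≤ ((3 : ℝ≥0∞) ^ n)⁻¹ := by
  by_cases h : ∃ w, shift w n = z
  · obtain ⟨w, rfl⟩ := h
    have h1 := blowUpLaw_pi (Finset.range n) w
    rw [Finset.card_range] at h1
    rw [← h1]
    exact measure_mono fun ω hω k hk => shift_inj hω k (Finset.mem_range.1 hk)
  · have h0 : {ω | shift ω n = z} = ∅ := Set.eq_empty_of_forall_notMem fun ω hω => h ⟨ω, hω⟩
    rw [h0, measure_empty]
    exact zero_le

/-- Almost surely the blow-up is not eventually constant. -/
theorem ae_boundaryInf_eq_empty : ∀ᵐ ω ∂blowUpLaw, boundaryInf ω = ∅ := by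
  have h : ∀ (m : ℕ) (a : Fin 3), ∀ᵐ ω ∂blowUpLaw, ¬ ∀ n ≥ m, ω n = a := by
    intro m a
    rw [ae_iff]
    simp only [not_not]
    refine le_antisymm (ge_of_tendsto' tendsto_inv_three_pow fun n => ?_) zero_le
    have h1 := blowUpLaw_pi (Finset.Ico m (m + n)) fun _ => a
    rw [Nat.card_Ico, Nat.add_sub_cancel_left] at h1
    rw [← h1]
    exact measure_mono fun ω hω k hk => hω k (Finset.mem_Ico.1 hk).1
  filter_upwards [ae_all_iff.2 fun m => ae_all_iff.2 (h m)] with ω hω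
  rw [Set.eq_empty_iff_forall_notMem]
  intro z hz
  obtain ⟨m, a, hma⟩ := eventually_const_of_mem_boundaryInf hz
  exact hω m a hma

noncomputable instance fintype_vertex_gasket (n : ℕ) (B : Set ℂ) : Fintype (Vertex (gasket n) B) :=
  Fintype.ofFinite _

open Classical in
/-- The squared distance, for the counting measure, of the indicator function of a vertex to the
span of the Neumann-Dirichlet eigenfunctions of level `n`. -/
noncomputable def defect (n : ℕ) : Vertex (gasket n) ∅ → ℝ :=
  (exists_sq_dist_sum_eq (neumannDirichletSpan n)).choose

theorem defect_nonneg (n : ℕ) (x : Vertex (gasket n) ∅) : 0 ≤ defect n x := by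
  classical
  exact (exists_sq_dist_sum_eq (neumannDirichletSpan n)).choose_spec.1 x

theorem sum_defect (n : ℕ) : ∑ x, defect n x =
    (verts (gasket n)).ncard - Module.finrank ℝ (neumannDirichletSpan n) := by
  classical
  rw [← card_vertex, Nat.card_eq_fintype_card]
  exact (exists_sq_dist_sum_eq (neumannDirichletSpan n)).choose_spec.2.1

open Classical in
theorem exists_sum_sq_eq_defect (n : ℕ) (x : Vertex (gasket n) ∅) :
    ∃ F ∈ neumannDirichletSpan n,
      ∑ y, ((Pi.single x 1 : Vertex (gasket n) ∅ → ℝ) - F) y ^ 2 = defect n x :=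
  (exists_sq_dist_sum_eq (neumannDirichletSpan n)).choose_spec.2.2 x

/-- The blow-ups for which the point `z` of the lattice of level `n` is badly approximated by
Neumann-Dirichlet eigenfunctions of that level. -/
def badBlowUps (n : ℕ) (z : ℂ) (e : ℝ) : Set (ℕ → Fin 3) :=
  {ω | ∃ x : Vertex (gasket n) ∅, z + shift ω n = x.point ∧ e ≤ defect n x}

/-- The position of the point `z` in the lattice of level `n` is a random vertex of the latter, and
each vertex has probability at most `3⁻ⁿ`. -/
theorem blowUpLaw_badBlowUps_le (n : ℕ) (z : ℂ) {e : ℝ} (he : 0 < e) :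
    blowUpLaw (badBlowUps n z e) ≤ ((3 : ℝ≥0∞) ^ n)⁻¹ *
      ((verts (gasket n)).ncard - Module.finrank ℝ (neumannDirichletSpan n) : ℝ≥0∞) /
        ENNReal.ofReal e := by
  classical
  set s : Finset (Vertex (gasket n) ∅) := {x | e ≤ defect n x} with hs
  have hsub : badBlowUps n z e ⊆ ⋃ x ∈ s, {ω | shift ω n = x.point - z} := by
    rintro ω ⟨x, hx, hex⟩
    refine Set.mem_biUnion (x := x) (by simpa [hs] using hex) ?_
    exact eq_sub_of_add_eq' hx
  have hcard : (s.card : ℝ) * e ≤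
      (verts (gasket n)).ncard - Module.finrank ℝ (neumannDirichletSpan n) := by
    rw [← sum_defect, ← nsmul_eq_mul, ← Finset.sum_const]
    refine (Finset.sum_le_sum fun x hx => (Finset.mem_filter.1 hx).2).trans ?_
    exact Finset.sum_le_univ_sum_of_nonneg (defect_nonneg n)
  have hcard' : (s.card : ℝ≥0∞) * ENNReal.ofReal e ≤
      ((verts (gasket n)).ncard - Module.finrank ℝ (neumannDirichletSpan n) : ℝ≥0∞) := by
    have h := ENNReal.ofReal_le_ofReal hcard
    rwa [ENNReal.ofReal_mul (by positivity), ENNReal.ofReal_natCast,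
      ENNReal.ofReal_sub _ (by positivity), ENNReal.ofReal_natCast, ENNReal.ofReal_natCast] at h
  have he' : ENNReal.ofReal e ≠ 0 := by simpa using he
  rw [ENNReal.le_div_iff_mul_le (Or.inl he') (Or.inl ENNReal.ofReal_ne_top)]
  calc _ ≤ (∑ x ∈ s, ((3 : ℝ≥0∞) ^ n)⁻¹) * ENNReal.ofReal e := by
        gcongr
        refine (measure_mono hsub).trans ((measure_biUnion_finset_le _ _).trans ?_)
        exact Finset.sum_le_sum fun x _ => blowUpLaw_shift_le n _
    _ = ((3 : ℝ≥0∞) ^ n)⁻¹ * (s.card * ENNReal.ofReal e) := by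
        rw [Finset.sum_const, nsmul_eq_mul]
        ring
    _ ≤ _ := by gcongr

/-- Almost surely, every point of the lattice is approximated arbitrarily well by
Neumann-Dirichlet eigenfunctions. -/
theorem ae_exists_notMem_badBlowUps : ∀ᵐ ω ∂blowUpLaw, ∀ z ∈ triLattice, ∀ q m : ℕ,
    ∃ n ≥ m, ω ∉ badBlowUps n z (1 / (q + 1)) := by
  rw [ae_ball_iff countable_triLattice]
  intro z _
  rw [ae_all_iff]
  intro q
  rw [ae_all_iff]
  intro m
  rw [ae_iff]
  have he : (0 : ℝ) < 1 / (q + 1) := by positivity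
  have hlim := ENNReal.Tendsto.div_const tendsto_codim_neumannDirichletSpan
    (b := ENNReal.ofReal (1 / (q + 1))) (Or.inr (by simpa using he))
  rw [ENNReal.zero_div] at hlim
  refine le_antisymm (ge_of_tendsto hlim ?_) zero_le
  filter_upwards [eventually_ge_atTop m] with n hn
  refine (measure_mono fun ω hω => ?_).trans (blowUpLaw_badBlowUps_le n z he)
  by_contra h
  exact hω ⟨n, hn, h⟩

/-! ### Eigenfunctions of the infinite lattice -/

/-- A vertex of the lattice of level `n`, as a vertex of the infinite lattice. -/
noncomputable def embedVertex (ω : ℕ → Fin 3) (n : ℕ) (x : Vertex (gasket n) ∅) :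
    Vertex (cellsInf ω) ∅ where
  point := x.point - shift ω n
  mem := by
    refine ⟨verts_mono (Set.subset_iUnion (cells ω) n) ?_, by simp⟩
    rw [mem_verts_cells_iff, sub_add_cancel]
    exact x.mem.1

theorem embedVertex_injective (ω : ℕ → Fin 3) (n : ℕ) : Function.Injective (embedVertex ω n) :=
  fun _ _ h => Vertex.ext (sub_left_injective (congrArg Vertex.point h))

theorem translate_embedVertex (ω : ℕ → Fin 3) (n : ℕ) (f : Vertex (gasket n) ∅ → ℝ)
    (x : Vertex (gasket n) ∅) :
    translate (cellsInf ω) ∅ (gasket n) (shift ω n) f (embedVertex ω n x) = f x := by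
  change extend f (x.point - shift ω n + shift ω n) = f x
  rw [sub_add_cancel, extend_apply]

theorem translate_of_notMem_range (ω : ℕ → Fin 3) (n : ℕ) (f : Vertex (gasket n) ∅ → ℝ)
    {y : Vertex (cellsInf ω) ∅} (hy : y ∉ Set.range (embedVertex ω n)) :
    translate (cellsInf ω) ∅ (gasket n) (shift ω n) f y = 0 := by
  refine extend_of_notMem f fun h => hy ⟨⟨_, h, by simp⟩, Vertex.ext ?_⟩
  simp [embedVertex]

theorem finite_support_translate (ω : ℕ → Fin 3) (n : ℕ) (f : Vertex (gasket n) ∅ → ℝ) :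
    (Function.support (translate (cellsInf ω) ∅ (gasket n) (shift ω n) f)).Finite :=
  (Set.finite_range (embedVertex ω n)).subset fun _ hy => by
    by_contra h
    exact hy (translate_of_notMem_range ω n f h)

/-- Extension by `0` from the lattice of level `n` to the infinite lattice, with values in
`L²`. -/
noncomputable def extensionL2 (ω : ℕ → Fin 3) (n : ℕ) :
    (Vertex (gasket n) ∅ → ℝ) →ₗ[ℝ] L2 (cellsInf ω) ∅ where
  toFun f := (memLp_of_finite_support (finite_support_translate ω n f)).toLp _
  map_add' f g := by
    rw [← MemLp.toLp_add]
    exact MemLp.toLp_congr _ _ (by rw [map_add])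
  map_smul' r f := by
    rw [← MemLp.toLp_const_smul]
    exact MemLp.toLp_congr _ _ (by rw [map_smul]; rfl)

theorem coe_extensionL2 (ω : ℕ → Fin 3) (n : ℕ) (f : Vertex (gasket n) ∅ → ℝ) :
    (extensionL2 ω n f : Vertex (cellsInf ω) ∅ → ℝ) =
      translate (cellsInf ω) ∅ (gasket n) (shift ω n) f :=
  coe_toLp (memLp_of_finite_support (finite_support_translate ω n f))

/-- A vertex has mass at most `3`, so the squared norm of `L²` is at most three times the one for
the counting measure. -/
theorem norm_sq_extensionL2_le (ω : ℕ → Fin 3) (n : ℕ) (f : Vertex (gasket n) ∅ → ℝ) :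
    ‖extensionL2 ω n f‖ ^ 2 ≤ 3 * ∑ x, f x ^ 2 := by
  classical
  rw [← real_inner_self_eq_norm_sq,
    inner_eq_sum _ _ (Finset.univ.image (embedVertex ω n)) fun y hy => ?_,
    Finset.sum_image fun x _ y _ h => embedVertex_injective ω n h, Finset.mul_sum]
  · refine Finset.sum_le_sum fun x _ => ?_
    rw [coe_extensionL2, translate_embedVertex, ← sq]
    gcongr
    exact_mod_cast mass_le_three _ _
  · rw [coe_extensionL2]
    exact translate_of_notMem_range ω n f fun ⟨x, hx⟩ =>
      hy (Finset.mem_image.2 ⟨x, Finset.mem_univ x, hx⟩)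

open Classical in
theorem extensionL2_single (ω : ℕ → Fin 3) (n : ℕ) (x : Vertex (gasket n) ∅) :
    extensionL2 ω n (Pi.single x 1) = deltaL2 (embedVertex ω n x) := by
  refine ext_L2 (funext fun y => ?_)
  rw [coe_extensionL2, deltaL2, coe_toLp]
  by_cases hy : y ∈ Set.range (embedVertex ω n)
  · obtain ⟨x', rfl⟩ := hy
    rw [translate_embedVertex]
    by_cases h : x' = x
    · rw [h, Pi.single_eq_same, Pi.single_eq_same]
    · rw [Pi.single_eq_of_ne h, Pi.single_eq_of_ne fun h' => h (embedVertex_injective ω n h')]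
  · rw [translate_of_notMem_range ω n _ hy, Pi.single_eq_of_ne]
    rintro rfl
    exact hy ⟨x, rfl⟩

theorem hamL2_extensionL2 {n : ℕ} {l : ℝ} {f : Vertex (gasket n) ∅ → ℝ}
    (hf : f ∈ neumannDirichlet n l) (ω : ℕ → Fin 3) :
    hamL2 (cellsInf ω) ∅ (extensionL2 ω n f) = l • extensionL2 ω n f := by
  refine ext_L2 ?_
  rw [coe_hamL2, coe_smul_L2, coe_extensionL2]
  exact Module.End.mem_eigenspace_iff.1 (translate_cellsInf_mem hf ω)

/-- Countably many extensions by `0` of Neumann-Dirichlet eigenfunctions span all of them. -/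
theorem exists_seq_eigenfunctions (ω : ℕ → Fin 3) :
    ∃ (v : ℕ → L2 (cellsInf ω) ∅) (l : ℕ → ℝ), (∀ k, hamL2 (cellsInf ω) ∅ (v k) = l k • v k) ∧
      (∀ k, {x | v k x ≠ 0}.Finite) ∧
      ∀ n, ∀ f ∈ neumannDirichletSpan n,
        extensionL2 ω n f ∈ Submodule.span ℝ (Set.range v) := by
  have hU : ∀ n, ∃ U : Finset (Vertex (gasket n) ∅ → ℝ),
      (U : Set (Vertex (gasket n) ∅ → ℝ)) ⊆ ⋃ l, (neumannDirichlet n l : Set _) ∧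
      neumannDirichletSpan n = Submodule.span ℝ U := by
    intro n
    rw [neumannDirichletSpan, Submodule.iSup_eq_span]
    exact (Submodule.fg_span_iff_fg_span_finset_subset _).1 (IsNoetherian.noetherian _)
  choose U hU1 hU2 using hU
  have hcount : (insert 0 (⋃ n, extensionL2 ω n '' (U n : Set _))).Countable :=
    (Set.countable_iUnion fun n => ((U n).countable_toSet.image _)).insert 0
  obtain ⟨v, hv⟩ := hcount.exists_eq_range ⟨0, Set.mem_insert _ _⟩
  have hprop : ∀ k, ∃ l : ℝ, hamL2 (cellsInf ω) ∅ (v k) = l • v k ∧ {x | v k x ≠ 0}.Finite := by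
    intro k
    have hk : v k ∈ insert 0 (⋃ n, extensionL2 ω n '' (U n : Set _)) := hv ▸ ⟨k, rfl⟩
    rcases hk with h0 | hk
    · refine ⟨0, ?_, ?_⟩
      · rw [h0, map_zero, smul_zero]
      · rw [h0, coe_zero_L2]
        simp
    · obtain ⟨n, f, hf, hfk⟩ := Set.mem_iUnion.1 hk
      obtain ⟨l, hl⟩ := Set.mem_iUnion.1 (hU1 n hf)
      refine ⟨l, ?_, ?_⟩
      · rw [← hfk]
        exact hamL2_extensionL2 hl ω
      · rw [← hfk, coe_extensionL2]
        exact finite_support_translate ω n f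
  choose l hl hfin using hprop
  refine ⟨v, l, hl, hfin, fun n f hf => ?_⟩
  rw [hU2] at hf
  have h1 := Submodule.mem_map_of_mem (f := extensionL2 ω n) hf
  rw [Submodule.map_span] at h1
  refine Submodule.span_mono ?_ h1
  rw [← hv]
  exact (Set.subset_iUnion (fun n => extensionL2 ω n '' (U n : Set _)) n).trans
    (Set.subset_insert _ _)

theorem purePoint_of_forall_notMem_badBlowUps {ω : ℕ → Fin 3}
    (h : ∀ z ∈ triLattice, ∀ q m : ℕ, ∃ n ≥ m, ω ∉ badBlowUps n z (1 / (q + 1))) :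
    PurePointWithCompactSupport (cellsInf ω) ∅ := by
  classical
  obtain ⟨v, l, hv, hfin, hspan⟩ := exists_seq_eigenfunctions ω
  refine purePoint_of_span_dense hv hfin (orthogonal_eq_bot_of_deltaL2 fun x e he => ?_)
  obtain ⟨m, hm⟩ : ∃ m, x.point ∈ verts (cells ω m) := by
    obtain ⟨c, hc, a, ha⟩ := x.mem.1
    obtain ⟨m, hm⟩ := Set.mem_iUnion.1 hc
    exact ⟨m, c, hm, a, ha⟩
  obtain ⟨q, hq⟩ := exists_nat_one_div_lt (show 0 < e ^ 2 / 3 by positivity)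
  obtain ⟨n, hn, hbad⟩ := h x.point (verts_cellsInf_subset ω x.mem.1) q m
  have hmem : x.point + shift ω n ∈ verts (gasket n) :=
    mem_verts_cells_iff.1 (verts_mono (cells_mono ω hn) hm)
  set y : Vertex (gasket n) ∅ := ⟨x.point + shift ω n, hmem, by simp⟩ with hy
  have hyx : embedVertex ω n y = x := Vertex.ext (by simp [embedVertex, hy])
  have hdef : defect n y < 1 / (q + 1) := by
    by_contra hlt
    exact hbad ⟨y, rfl, not_lt.1 hlt⟩
  obtain ⟨F, hF, hFd⟩ := exists_sum_sq_eq_defect n y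
  refine ⟨extensionL2 ω n F, hspan n F hF, ?_⟩
  rw [← hyx, ← extensionL2_single, ← map_sub]
  refine abs_le_of_sq_le_sq' ?_ he.le |>.2
  refine (norm_sq_extensionL2_le ω n _).trans ?_
  rw [hFd]
  linarith

end SierpinskiLattice

theorem theorem5p2 :
    (∀ ω : ℕ → Fin 3,
      SierpinskiLattice.IsDensityOfStates ω SierpinskiLattice.gasketDensity ∧
      SierpinskiLattice.IsNDDensity ω SierpinskiLattice.gasketDensity) ∧
    (∀ᵐ ω ∂SierpinskiLattice.blowUpLaw,
      SierpinskiLattice.PurePointWithCompactSupport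
        (SierpinskiLattice.cellsInf ω) ∅ ∧
      SierpinskiLattice.PurePointWithCompactSupport
        (SierpinskiLattice.cellsInf ω) (SierpinskiLattice.boundaryInf ω)) := by
  refine ⟨fun ω => ⟨SierpinskiLattice.isDensityOfStates_gasketDensity ω,
    SierpinskiLattice.isNDDensity_gasketDensity ω⟩, ?_⟩
  filter_upwards [SierpinskiLattice.ae_exists_notMem_badBlowUps,
    SierpinskiLattice.ae_boundaryInf_eq_empty] with ω h1 h2
  rw [h2]
  exact ⟨SierpinskiLattice.purePoint_of_forall_notMem_badBlowUps h1,
    SierpinskiLattice.purePoint_of_forall_notMem_badBlowUps h1⟩
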